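/- Let $n,m\ge 0$ be integers, let $A,Q\in\mathbb{R}^{n\times n}$, $B,S\in\mathbb{R}^{n\times m}$, $R\in\mathbb{R}^{m\times m}$, and assume that $$\Pi=\begin{bmatrix}Q&S\\S^{T}&R\end{bmatrix}=\Pi^{T}\ge 0 .$$ Let $R^{\dagger}$ be the Moore--Penrose pseudo-inverse of $R$ and $G=I_m-R^{\dagger}R$. A matrix $X\in\mathbb{R}^{n\times n}$ is a solution of CGCARE if $$XA+A^{T}X-(S+XB)R^{\dagger}(S^{T}+B^{T}X)+Q=0\quad\text{and}\quad \ker R\subseteq\ker(S+XB).$$ A control is a function $u\in L^2_{\mathrm{loc}}([0,\infty);\mathbb{R}^m)$; for $x_0\in\mathbb{R}^n$ its trajectory $x$ is the (Carathéodory) solution of $\dot x=Ax+Bu$, $x(0)=x_0$, and its cost is $$J_\infty(x_0,u)=\int_0^\infty\begin{bmatrix}x(t)\\u(t)\end{bmatrix}^{T}\Pi\begin{bmatrix}x(t)\\u(t)\end{bmatrix}dt\in[0,\infty].$$ Suppose that CGCARE has a symmetric solution, and that for every $x_0\in\mathbb{R}^n$ there is a control $u$ with $J_\infty(x_0,u)<\infty$.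 Then: 1. The initial value problem $$\dot X(t)=X(t)A+A^{T}X(t)-(S+X(t)B)R^{\dagger}(S^{T}+B^{T}X(t))+Q,\qquad X(0)=0,$$ has exactly one solution on $[0,\infty)$; the limit $\bar X=\lim_{t\to\infty}X(t)$ exists, and $\bar X=\bar X^{T}\ge 0$ is a solution of CGCARE. 2. For every $x_0\in\mathbb{R}^n$, $\min_u J_\infty(x_0,u)=x_0^{T}\bar X x_0$ (in particular, the minimum is attained). 3. $\bar X$ is the minimum positive semidefinite solution of CGCARE: $\bar X\le X'$ for every solution $X'=X'^{T}\ge 0$ of CGCARE. 4. For every $x_0\in\mathbb{R}^n$, a control $u$ with trajectory $x$ minimises $J_\infty(x_0,\cdot)$ if and only if there is $v\in L^2_{\mathrm{loc}}([0,\infty);\mathbb{R}^m)$ such that $$u(t)=-R^{\dagger}(S^{T}+B^{T}\bar X)\,x(t)+G\,v(t)\quad\text{for almost every } t\ge 0;$$ moreover, every $v\in L^2_{\mathrm{loc}}([0,\infty);\mathbb{R}^m)$ arises in this way from an optimal control. -/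

import Mathlib

open Matrix MeasureTheory Filter Topology

/-- The four Penrose equations: `N` is a Moore-Penrose pseudo-inverse of the real matrix `M`. -/
structure IsMoorePenrose {k l : ℕ} (M : Matrix (Fin k) (Fin l) ℝ)
    (N : Matrix (Fin l) (Fin k) ℝ) : Prop where
  mul_mul_self : M * N * M = M
  inv_mul_mul : N * M * N = N
  symm_left : (M * N)ᵀ = M * N
  symm_right : (N * M)ᵀ = N * M

theorem IsMoorePenrose.unique {k l : ℕ} {M : Matrix (Fin k) (Fin l) ℝ}
    {N N' : Matrix (Fin l) (Fin k) ℝ} (h : IsMoorePenrose M N) (h' : IsMoorePenrose M N') :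
    N = N' := by
  have e1 : M * N = M * N' := by
    calc M * N = (M * N)ᵀ := h.symm_left.symm
      _ = ((M * N') * (M * N))ᵀ := by rw [← Matrix.mul_assoc, h'.mul_mul_self]
      _ = (M * N) * (M * N') := by rw [transpose_mul, h.symm_left, h'.symm_left]
      _ = M * N' := by rw [← Matrix.mul_assoc, h.mul_mul_self]
  have e2 : N * M = N' * M := by
    calc N * M = (N * M)ᵀ := h.symm_right.symm
      _ = ((N * M) * (N' * M))ᵀ := by
        rw [Matrix.mul_assoc, ← Matrix.mul_assoc M, h'.mul_mul_self]
      _ = (N' * M) * (N * M) := by rw [transpose_mul, h.symm_right, h'.symm_right]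
      _ = N' * M := by rw [Matrix.mul_assoc, ← Matrix.mul_assoc M, h.mul_mul_self]
  calc N = N * M * N := h.inv_mul_mul.symm
    _ = N' * M * N := by rw [e2]
    _ = N' * (M * N') := by rw [Matrix.mul_assoc, e1]
    _ = N' := by rw [← Matrix.mul_assoc, h'.inv_mul_mul]

theorem exists_isMoorePenrose_of_isHermitian {l : ℕ} {H : Matrix (Fin l) (Fin l) ℝ}
    (hH : H.IsHermitian) : ∃ N, IsMoorePenrose H N := by
  set U : Matrix (Fin l) (Fin l) ℝ := (hH.eigenvectorUnitary : Matrix (Fin l) (Fin l) ℝ) with hU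
  set d : Fin l → ℝ := hH.eigenvalues with hd
  have hUU : Uᵀ * U = 1 := by
    have h := Unitary.coe_star_mul_self hH.eigenvectorUnitary
    simpa [hU, star_eq_conjTranspose, conjTranspose_eq_transpose_of_trivial] using h
  have hspec : H = U * diagonal d * Uᵀ := by
    have h := hH.spectral_theorem
    simpa [hU, hd, Unitary.conjStarAlgAut_apply, star_eq_conjTranspose,
      conjTranspose_eq_transpose_of_trivial, Function.comp_def] using h
  have key : ∀ a b : Fin l → ℝ, (U * diagonal a * Uᵀ) * (U * diagonal b * Uᵀ)
      = U * diagonal (fun i => a i * b i) * Uᵀ := by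
    intro a b
    calc (U * diagonal a * Uᵀ) * (U * diagonal b * Uᵀ)
        = U * diagonal a * (Uᵀ * U) * diagonal b * Uᵀ := by simp only [Matrix.mul_assoc]
      _ = _ := by rw [hUU, Matrix.mul_one, Matrix.mul_assoc U, diagonal_mul_diagonal]
  have keyT : ∀ a : Fin l → ℝ, (U * diagonal a * Uᵀ)ᵀ = U * diagonal a * Uᵀ := by
    intro a
    simp [transpose_mul, Matrix.mul_assoc]
  refine ⟨U * diagonal (fun i => (d i)⁻¹) * Uᵀ, ?_, ?_, ?_, ?_⟩
  · rw [hspec, key, key]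
    congr 3; funext i
    by_cases h : d i = 0 <;> simp [h]
  · rw [hspec, key, key]
    congr 3; funext i
    by_cases h : d i = 0 <;> simp [h]
  · rw [hspec, key, keyT]
  · rw [hspec, key, keyT]

theorem exists_isMoorePenrose {k l : ℕ} (M : Matrix (Fin k) (Fin l) ℝ) :
    ∃ N, IsMoorePenrose M N := by
  have hH : (Mᵀ * M).IsHermitian := by
    rw [Matrix.IsHermitian, conjTranspose_eq_transpose_of_trivial, transpose_mul,
      transpose_transpose]
  obtain ⟨P, hP⟩ := exists_isMoorePenrose_of_isHermitian hH
  obtain ⟨P', hP'⟩ : ∃ P', P' = Pᵀ := ⟨_, rfl⟩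
  have hHT : (Mᵀ * M)ᵀ = Mᵀ * M := by rw [transpose_mul, transpose_transpose]
  have hPT : Pᵀ = P := by
    refine IsMoorePenrose.unique (M := Mᵀ * M) ⟨?_, ?_, ?_, ?_⟩ hP
    · have := congrArg Matrix.transpose hP.mul_mul_self
      simpa only [transpose_mul, transpose_transpose, Matrix.mul_assoc] using this
    · have := congrArg Matrix.transpose hP.inv_mul_mul
      simpa only [transpose_mul, transpose_transpose, Matrix.mul_assoc] using this
    · have := hP.symm_right
      rw [transpose_mul, hHT] at this
      rw [transpose_mul, transpose_transpose, hHT, this]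
    · have := hP.symm_left
      rw [transpose_mul, hHT] at this
      rw [transpose_mul, transpose_transpose, hHT, this]
  have hM : M * (P * (Mᵀ * M)) = M := by
    have h0 : (M * (P * (Mᵀ * M)) - M)ᵀ * (M * (P * (Mᵀ * M)) - M) = 0 := by
      have h1 : Mᵀ * (M * (P * (Mᵀ * M)) - M) = 0 := by
        rw [Matrix.mul_sub, sub_eq_zero]
        simpa only [Matrix.mul_assoc] using hP.mul_mul_self
      have h2 : (M * (P * (Mᵀ * M)) - M)ᵀ = ((P * (Mᵀ * M))ᵀ - 1) * Mᵀ := by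
        rw [transpose_sub, transpose_mul, Matrix.sub_mul, Matrix.one_mul]
      rw [h2, Matrix.mul_assoc, h1, Matrix.mul_zero]
    rw [← conjTranspose_eq_transpose_of_trivial, conjTranspose_mul_self_eq_zero] at h0
    exact sub_eq_zero.mp h0
  refine ⟨P * Mᵀ, ?_, ?_, ?_, ?_⟩
  · simpa only [Matrix.mul_assoc] using hM
  · have := congrArg (· * Mᵀ) hP.inv_mul_mul
    simpa only [Matrix.mul_assoc] using this
  · rw [transpose_mul, transpose_mul, transpose_transpose, hPT, Matrix.mul_assoc]
  · have := hP.symm_right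
    simpa only [Matrix.mul_assoc] using this

/-- The Moore-Penrose pseudo-inverse of a real matrix. -/
noncomputable def pinv {k l : ℕ} (M : Matrix (Fin k) (Fin l) ℝ) : Matrix (Fin l) (Fin k) ℝ :=
  (exists_isMoorePenrose M).choose

theorem pinv_spec {k l : ℕ} (M : Matrix (Fin k) (Fin l) ℝ) : IsMoorePenrose M (pinv M) :=
  (exists_isMoorePenrose M).choose_spec

/-- The projector `G = I - R† R` (onto the kernel of `R`). -/
noncomputable def kerProj {m : ℕ} (R : Matrix (Fin m) (Fin m) ℝ) : Matrix (Fin m) (Fin m) ℝ :=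
  1 - pinv R * R

/-- The generalised Riccati operator
`X ↦ X A + Aᵀ X - (S + X B) R† (Sᵀ + Bᵀ X) + Q`. -/
noncomputable def riccati {n m : ℕ} (A : Matrix (Fin n) (Fin n) ℝ) (B : Matrix (Fin n) (Fin m) ℝ)
    (Q : Matrix (Fin n) (Fin n) ℝ) (S : Matrix (Fin n) (Fin m) ℝ) (R : Matrix (Fin m) (Fin m) ℝ)
    (X : Matrix (Fin n) (Fin n) ℝ) : Matrix (Fin n) (Fin n) ℝ :=
  X * A + Aᵀ * X - (S + X * B) * pinv R * (Sᵀ + Bᵀ * X) + Q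

/-- `X` solves the constrained generalised continuous algebraic Riccati equation: the Riccati
operator vanishes at `X` and `ker R ⊆ ker (S + X B)`. -/
def IsCGCARE {n m : ℕ} (A : Matrix (Fin n) (Fin n) ℝ) (B : Matrix (Fin n) (Fin m) ℝ)
    (Q : Matrix (Fin n) (Fin n) ℝ) (S : Matrix (Fin n) (Fin m) ℝ) (R : Matrix (Fin m) (Fin m) ℝ)
    (X : Matrix (Fin n) (Fin n) ℝ) : Prop :=
  riccati A B Q S R X = 0 ∧
    LinearMap.ker (Matrix.mulVecLin R) ≤ LinearMap.ker (Matrix.mulVecLin (S + X * B))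

/-- `X` solves the forward generalised Riccati differential equation on `[0, ∞)` with the initial
condition `X 0 = 0` (derivatives entry by entry, one-sided at `0`). -/
def IsForwardRiccatiSolution {n m : ℕ} (A : Matrix (Fin n) (Fin n) ℝ)
    (B : Matrix (Fin n) (Fin m) ℝ) (Q : Matrix (Fin n) (Fin n) ℝ) (S : Matrix (Fin n) (Fin m) ℝ)
    (R : Matrix (Fin m) (Fin m) ℝ) (X : ℝ → Matrix (Fin n) (Fin n) ℝ) : Prop :=
  X 0 = 0 ∧ ∀ t : ℝ, 0 ≤ t → ∀ i j,
    HasDerivWithinAt (fun s => X s i j) (riccati A B Q S R (X t) i j) (Set.Ici 0) t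

/-- Functions on `[0, ∞)` that are square integrable on bounded intervals. -/
def IsL2Loc {m : ℕ} (u : ℝ → Fin m → ℝ) : Prop :=
  ∀ T : ℝ, MemLp u 2 (volume.restrict (Set.Icc 0 T))

/-- `u` is a control on `[0, ∞)` and `x` is its state trajectory from `x₀`, that is, the
(Carathéodory) solution of `ẋ = A x + B u`, `x(0) = x₀`, on `[0, ∞)`. -/
structure IsTrajectory {n m : ℕ} (A : Matrix (Fin n) (Fin n) ℝ) (B : Matrix (Fin n) (Fin m) ℝ)
    (x₀ : Fin n → ℝ) (u : ℝ → Fin m → ℝ) (x : ℝ → Fin n → ℝ) : Prop where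
  control : IsL2Loc u
  continuousOn : ContinuousOn x (Set.Ici 0)
  eq_integral : ∀ t : ℝ, 0 ≤ t → x t = x₀ + ∫ s in (0 : ℝ)..t, (A *ᵥ x s + B *ᵥ u s)

/-- The infinite-horizon cost `∫₀^∞ [xᵀ uᵀ] Π [x; u] dt`, with values in `[0, ∞]`
(the integrand is nonnegative when `Π = [Q S; Sᵀ R]` is positive semidefinite). -/
noncomputable def cost {n m : ℕ} (Q : Matrix (Fin n) (Fin n) ℝ) (S : Matrix (Fin n) (Fin m) ℝ)
    (R : Matrix (Fin m) (Fin m) ℝ) (u : ℝ → Fin m → ℝ) (x : ℝ → Fin n → ℝ) : ENNReal :=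
  ∫⁻ t in Set.Ici (0 : ℝ), ENNReal.ofReal
    (Sum.elim (x t) (u t) ⬝ᵥ (Matrix.fromBlocks Q S Sᵀ R *ᵥ Sum.elim (x t) (u t)))

/-- `u`, with trajectory `x`, minimises the infinite-horizon cost among all controls for the
initial state `x₀`. -/
def IsOptimal {n m : ℕ} (A : Matrix (Fin n) (Fin n) ℝ) (B : Matrix (Fin n) (Fin m) ℝ)
    (Q : Matrix (Fin n) (Fin n) ℝ) (S : Matrix (Fin n) (Fin m) ℝ) (R : Matrix (Fin m) (Fin m) ℝ)
    (x₀ : Fin n → ℝ) (u : ℝ → Fin m → ℝ) (x : ℝ → Fin n → ℝ) : Prop :=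
  IsTrajectory A B x₀ u x ∧
    ∀ u' x', IsTrajectory A B x₀ u' x' → cost Q S R u x ≤ cost Q S R u' x'

/-- Along `x`, the control `u` has the form `-R† (Sᵀ + Bᵀ X) x(t) + G v(t)` for almost every
`t ≥ 0`. -/
def IsFeedback {n m : ℕ} (B : Matrix (Fin n) (Fin m) ℝ) (S : Matrix (Fin n) (Fin m) ℝ)
    (R : Matrix (Fin m) (Fin m) ℝ) (X : Matrix (Fin n) (Fin n) ℝ)
    (v u : ℝ → Fin m → ℝ) (x : ℝ → Fin n → ℝ) : Prop :=
  ∀ᵐ t ∂(volume.restrict (Set.Ici (0 : ℝ))),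
    u t = -((pinv R * (Sᵀ + Bᵀ * X)) *ᵥ x t) + kerProj R *ᵥ v t

/-! Put `A₀ = A - B R† Sᵀ`, `M = B R† Bᵀ ≥ 0`, `Q₀ = Q - S R† Sᵀ ≥ 0`. The Riccati operator becomes
the ordinary one, `X A₀ + A₀ᵀ X - X M X + Q₀`, and its flow from `0` is `Z Y⁻¹` for a linear
Hamiltonian system. Positivity of `M` and `Q₀` keeps `Y` invertible for all `t ≥ 0`; conserved
quantities give `X(t)ᵀ = X(t)` and `X' = Y⁻ᵀ Q₀ Y⁻¹ ≥ 0`.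

As `R` may be singular, the square in the cost can be completed only where `(S + X B) G = 0`. The
symmetric solution of CGCARE supplies this: its kernel is `A₀`-invariant, killed by `Q₀`, and
contains the range of `B G`, so the flow vanishes on it (`IsCGCARE.kerProj_invariance`,
`riccati_flow_mul_eq_zero`); and `S G = 0` since `Π ≥ 0`.

Completing the square with `P(t) = X(T - t)` shows that every control costs at least `x₀ᵀ X(T) x₀`
on `[0, T]`. A control of finite cost thus bounds the monotone flow, which converges to an
equilibrium `X̄`, still satisfying the constraint. With a constant solution `X' ≥ 0` instead, its
feedback law costs at most `x₀ᵀ X' x₀`. Comparing the two bounds gives both optimality and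
minimality of `X̄`. Conversely, optimality forces the square to vanish, so that `u + R†(Sᵀ + Bᵀ
X̄)x` lies in `ker R`, the range of `G`. -/

/-! ### The Riccati flow via a linear Hamiltonian system. -/

section RiccatiFlow

attribute [local instance] Matrix.linftyOpNormedRing Matrix.linftyOpNormedAlgebra

theorem HasDerivAt.linearMap_comp {E F : Type*} [NormedAddCommGroup E] [NormedSpace ℝ E]
    [FiniteDimensional ℝ E] [NormedAddCommGroup F] [NormedSpace ℝ F] (L : E →ₗ[ℝ] F)
    {f : ℝ → E} {f' : E} {t : ℝ} (hf : HasDerivAt f f' t) :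
    HasDerivAt (fun s => L (f s)) (L f') t :=
  (LinearMap.toContinuousLinearMap L).hasFDerivAt.comp_hasDerivAt t hf

theorem HasDerivAt.matrix_mulVec {n : ℕ} {Y : ℝ → Matrix (Fin n) (Fin n) ℝ}
    {Y' : Matrix (Fin n) (Fin n) ℝ} {t : ℝ} (hY : HasDerivAt Y Y' t) (v : Fin n → ℝ) :
    HasDerivAt (fun s => Y s *ᵥ v) (Y' *ᵥ v) t :=
  hY.linearMap_comp ((Matrix.mulVecBilin ℝ ℝ).flip v)

theorem HasDerivAt.matrix_transpose {n : ℕ} {Y : ℝ → Matrix (Fin n) (Fin n) ℝ}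
    {Y' : Matrix (Fin n) (Fin n) ℝ} {t : ℝ} (hY : HasDerivAt Y Y' t) :
    HasDerivAt (fun s => (Y s)ᵀ) Y'ᵀ t :=
  hY.linearMap_comp (Matrix.transposeLinearEquiv (Fin n) (Fin n) ℝ ℝ).toLinearMap

theorem HasDerivAt.matrix_dotProduct {n : ℕ} {y z : ℝ → Fin n → ℝ} {y' z' : Fin n → ℝ} {t : ℝ}
    (hy : HasDerivAt y y' t) (hz : HasDerivAt z z' t) :
    HasDerivAt (fun s => y s ⬝ᵥ z s) (y' ⬝ᵥ z t + y t ⬝ᵥ z') t := by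
  have h := HasDerivAt.fun_sum (u := Finset.univ)
    fun i _ => (hasDerivAt_pi.1 hy i).fun_mul (hasDerivAt_pi.1 hz i)
  simpa [dotProduct, Finset.sum_add_distrib] using h

theorem Matrix.IsSymm.of_posSemidef {n : Type*} {X : Matrix n n ℝ} (h : X.PosSemidef) : Xᵀ = X := by
  simpa [Matrix.IsHermitian, conjTranspose_eq_transpose_of_trivial] using h.isHermitian

theorem Matrix.PosSemidef.dotProduct_nonneg {n : Type*} [Fintype n] {X : Matrix n n ℝ}
    (h : X.PosSemidef) (x : n → ℝ) : 0 ≤ x ⬝ᵥ (X *ᵥ x) := by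
  simpa using h.dotProduct_mulVec_nonneg x

theorem Matrix.PosSemidef.of_dotProduct_nonneg {n : Type*} [Fintype n] {X : Matrix n n ℝ}
    (h : Xᵀ = X) (h' : ∀ x : n → ℝ, 0 ≤ x ⬝ᵥ (X *ᵥ x)) : X.PosSemidef :=
  .of_dotProduct_mulVec_nonneg
    (by rw [Matrix.IsHermitian, conjTranspose_eq_transpose_of_trivial, h]) (by simpa using h')

/-- The linear Hamiltonian flow of a Riccati equation. -/
theorem exists_hamiltonian_flow {n : ℕ} (A M Q : Matrix (Fin n) (Fin n) ℝ) :
    ∃ Y Z : ℝ → Matrix (Fin n) (Fin n) ℝ, Y 0 = 1 ∧ Z 0 = 0 ∧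
      (∀ t, HasDerivAt Y (-A * Y t + M * Z t) t) ∧
      (∀ t, HasDerivAt Z (Q * Y t + Aᵀ * Z t) t) := by
  set H : Matrix (Fin n ⊕ Fin n) (Fin n ⊕ Fin n) ℝ := fromBlocks (-A) M Q Aᵀ with hH
  set P : ℝ → Matrix (Fin n ⊕ Fin n) (Fin n ⊕ Fin n) ℝ := fun t => NormedSpace.exp (t • H) with hP
  have hd : ∀ t, HasDerivAt P (H * P t) t := fun t => hasDerivAt_exp_smul_const' H t
  have hblocks : ∀ t, H * P t = fromBlocks
      (-A * (P t).toBlocks₁₁ + M * (P t).toBlocks₂₁) (-A * (P t).toBlocks₁₂ + M * (P t).toBlocks₂₂)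
      (Q * (P t).toBlocks₁₁ + Aᵀ * (P t).toBlocks₂₁)
      (Q * (P t).toBlocks₁₂ + Aᵀ * (P t).toBlocks₂₂) := by
    intro t
    conv_lhs => rw [← fromBlocks_toBlocks (P t), hH, fromBlocks_multiply]
  have h0 : P 0 = 1 := by simp [hP]
  let L₁ : Matrix (Fin n ⊕ Fin n) (Fin n ⊕ Fin n) ℝ →ₗ[ℝ] Matrix (Fin n) (Fin n) ℝ :=
    { toFun := toBlocks₁₁, map_add' := fun _ _ => rfl, map_smul' := fun _ _ => rfl }
  let L₂ : Matrix (Fin n ⊕ Fin n) (Fin n ⊕ Fin n) ℝ →ₗ[ℝ] Matrix (Fin n) (Fin n) ℝ :=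
    { toFun := toBlocks₂₁, map_add' := fun _ _ => rfl, map_smul' := fun _ _ => rfl }
  refine ⟨fun t => (P t).toBlocks₁₁, fun t => (P t).toBlocks₂₁, ?_, ?_, fun t => ?_, fun t => ?_⟩
  · change (P 0).toBlocks₁₁ = 1
    rw [h0, ← fromBlocks_one, toBlocks_fromBlocks₁₁]
  · change (P 0).toBlocks₂₁ = 0
    rw [h0, ← fromBlocks_one, toBlocks_fromBlocks₂₁]
  · have h := (hd t).linearMap_comp L₁
    rw [hblocks] at h
    exact h
  · have h := (hd t).linearMap_comp L₂
    rw [hblocks] at h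
    exact h

theorem hamiltonian_flow_dotProduct {n : ℕ} {A M Q : Matrix (Fin n) (Fin n) ℝ}
    {Y Z : ℝ → Matrix (Fin n) (Fin n) ℝ}
    (hY : ∀ t, HasDerivAt Y (-A * Y t + M * Z t) t)
    (hZ : ∀ t, HasDerivAt Z (Q * Y t + Aᵀ * Z t) t) (v : Fin n → ℝ) (t : ℝ) :
    HasDerivAt (fun s => (Y s *ᵥ v) ⬝ᵥ (Z s *ᵥ v))
      ((Z t *ᵥ v) ⬝ᵥ (M *ᵥ (Z t *ᵥ v)) + (Y t *ᵥ v) ⬝ᵥ (Q *ᵥ (Y t *ᵥ v))) t := by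
  convert ((hY t).matrix_mulVec v).matrix_dotProduct ((hZ t).matrix_mulVec v) using 1
  simp only [add_mulVec, ← mulVec_mulVec, dotProduct_add, add_dotProduct, neg_mulVec,
    neg_dotProduct]
  rw [dotProduct_comm (M *ᵥ _), dotProduct_mulVec _ Aᵀ, vecMul_transpose]
  ring

theorem hamiltonian_flow_dotProduct_monotone {n : ℕ} {A M Q : Matrix (Fin n) (Fin n) ℝ}
    (hM : M.PosSemidef) (hQ : Q.PosSemidef) {Y Z : ℝ → Matrix (Fin n) (Fin n) ℝ}
    (hY : ∀ t, HasDerivAt Y (-A * Y t + M * Z t) t)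
    (hZ : ∀ t, HasDerivAt Z (Q * Y t + Aᵀ * Z t) t) (v : Fin n → ℝ) :
    Monotone fun s => (Y s *ᵥ v) ⬝ᵥ (Z s *ᵥ v) :=
  monotone_of_hasDerivAt_nonneg (hamiltonian_flow_dotProduct hY hZ v) fun _ =>
    add_nonneg (hM.dotProduct_nonneg _) (hQ.dotProduct_nonneg _)

/-- If `Y t v = 0`, the monotone function `(Y s v) ⬝ (Z s v)` vanishes at `0` and at `t`, hence in
between. Its derivative then vanishes too, so `M Z v = 0` and `y = Y v` solves `y' = -A y` with
`y(t) = 0`; thus `v = y(0) = 0`. -/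
theorem isUnit_hamiltonian_flow {n : ℕ} {A M Q : Matrix (Fin n) (Fin n) ℝ}
    (hM : M.PosSemidef) (hQ : Q.PosSemidef) {Y Z : ℝ → Matrix (Fin n) (Fin n) ℝ}
    (hY0 : Y 0 = 1) (hZ0 : Z 0 = 0)
    (hY : ∀ t, HasDerivAt Y (-A * Y t + M * Z t) t)
    (hZ : ∀ t, HasDerivAt Z (Q * Y t + Aᵀ * Z t) t) {t : ℝ} (ht : 0 ≤ t) : IsUnit (Y t) := by
  rw [← mulVec_injective_iff_isUnit]
  refine (injective_iff_map_eq_zero (mulVecLin (Y t))).2 fun v hv => ?_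
  rw [mulVecLin_apply] at hv
  have hmono := hamiltonian_flow_dotProduct_monotone hM hQ hY hZ v
  have hp : ∀ s ∈ Set.Icc 0 t, (Y s *ᵥ v) ⬝ᵥ (Z s *ᵥ v) = 0 := fun s hs =>
    le_antisymm (by simpa [hv] using hmono hs.2) (by simpa [hZ0] using hmono hs.1)
  have hMZ : ∀ s ∈ Set.Ico 0 t, M *ᵥ (Z s *ᵥ v) = 0 := by
    intro s hs
    rcases hs.1.eq_or_lt with rfl | h0
    · simp [hZ0]
    have hd : HasDerivAt (fun s => (Y s *ᵥ v) ⬝ᵥ (Z s *ᵥ v)) 0 s :=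
      (hasDerivAt_const s (0 : ℝ)).congr_of_eventuallyEq <| by
        filter_upwards [Icc_mem_nhds h0 hs.2] with r hr using hp r hr
    have h := (hamiltonian_flow_dotProduct hY hZ v s).unique hd
    have h1 := hM.dotProduct_nonneg (Z s *ᵥ v)
    have h2 := hQ.dotProduct_nonneg (Y s *ᵥ v)
    exact (hM.dotProduct_mulVec_zero_iff _).1 (by simpa using (by linarith :
      (Z s *ᵥ v) ⬝ᵥ (M *ᵥ (Z s *ᵥ v)) = 0))
  -- The integrating factor `exp (s A)` removes the term `-A Y`.
  have hd : ∀ s, HasDerivAt (fun s => (NormedSpace.exp (s • A) * Y s) *ᵥ v)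
      (NormedSpace.exp (s • A) *ᵥ (M *ᵥ (Z s *ᵥ v))) s := by
    intro s
    refine (((hasDerivAt_exp_smul_const A s).mul (hY s)).matrix_mulVec v).congr_deriv ?_
    rw [mulVec_mulVec, mulVec_mulVec]
    congr 1
    noncomm_ring
  have hc := constant_of_has_deriv_right_zero
    (f := fun s => (NormedSpace.exp (s • A) * Y s) *ᵥ v) (a := 0) (b := t)
    (fun s _ => (hd s).continuousAt.continuousWithinAt)
    (fun s hs => by simpa [hMZ s hs] using (hd s).hasDerivWithinAt) t ⟨ht, le_rfl⟩
  simpa [← mulVec_mulVec, hv, hY0, eq_comm] using hc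

theorem HasDerivAt.matrix_inv {n : ℕ} {Y : ℝ → Matrix (Fin n) (Fin n) ℝ}
    {Y' : Matrix (Fin n) (Fin n) ℝ} {t : ℝ} (hY : HasDerivAt Y Y' t) (hU : IsUnit (Y t)) :
    HasDerivAt (fun s => (Y s)⁻¹) (-((Y t)⁻¹ * Y' * (Y t)⁻¹)) t := by
  obtain ⟨u, hu⟩ := hU
  have h := (hasFDerivAt_ringInverse (𝕜 := ℝ) u)
  rw [hu] at h
  have h' := h.comp_hasDerivAt t hY
  simp only [nonsing_inv_eq_ringInverse]
  refine h'.congr_deriv ?_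
  simp [← hu]

/-- Take `X = Z Y⁻¹`. Symmetry and positivity come by congruence from `Yᵀ Z`, and the sign of `X'`
from conservation of the Hamiltonian, whose initial value is `Q`. -/
theorem exists_riccati_flow {n : ℕ} {A M Q : Matrix (Fin n) (Fin n) ℝ} (hM : M.PosSemidef)
    (hQ : Q.PosSemidef) : ∃ X : ℝ → Matrix (Fin n) (Fin n) ℝ, X 0 = 0 ∧
      (∀ t, 0 ≤ t → HasDerivAt X (X t * A + Aᵀ * X t - X t * M * X t + Q) t) ∧
      (∀ t, 0 ≤ t → (X t).PosSemidef) ∧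
      (∀ t, 0 ≤ t → (X t * A + Aᵀ * X t - X t * M * X t + Q).PosSemidef) := by
  obtain ⟨Y, Z, hY0, hZ0, hY, hZ⟩ := exists_hamiltonian_flow A M Q
  have hMT := Matrix.IsSymm.of_posSemidef hM
  have hQT := Matrix.IsSymm.of_posSemidef hQ
  have hU : ∀ t, 0 ≤ t → IsUnit (Y t) := fun t => isUnit_hamiltonian_flow hM hQ hY0 hZ0 hY hZ
  have hsymm : ∀ t, (Y t)ᵀ * Z t - (Z t)ᵀ * Y t = 0 := by
    have hd : ∀ t, HasDerivAt (fun s => (Y s)ᵀ * Z s - (Z s)ᵀ * Y s) 0 t := by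
      intro t
      refine (((hY t).matrix_transpose.mul (hZ t)).sub
        ((hZ t).matrix_transpose.mul (hY t))).congr_deriv ?_
      simp only [transpose_add, transpose_mul, transpose_neg, hMT, hQT, transpose_transpose]
      noncomm_ring
    intro t
    have := is_const_of_deriv_eq_zero (fun s => (hd s).differentiableAt) (fun s => (hd s).deriv) t 0
    simpa [hY0, hZ0] using this
  have hham : ∀ t, (Y t)ᵀ * Q * Y t + (Z t)ᵀ * A * Y t + (Y t)ᵀ * Aᵀ * Z t - (Z t)ᵀ * M * Z t
      = Q := by
    have hd : ∀ t, HasDerivAt (fun s => (Y s)ᵀ * Q * Y s + (Z s)ᵀ * A * Y s + (Y s)ᵀ * Aᵀ * Z s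
        - (Z s)ᵀ * M * Z s) 0 t := by
      intro t
      refine ((((((hY t).matrix_transpose.mul_const Q).mul (hY t)).add
        (((hZ t).matrix_transpose.mul_const A).mul (hY t))).add
        (((hY t).matrix_transpose.mul_const Aᵀ).mul (hZ t))).sub
        (((hZ t).matrix_transpose.mul_const M).mul (hZ t))).congr_deriv ?_
      simp only [transpose_add, transpose_mul, transpose_neg, hMT, hQT, transpose_transpose]
      noncomm_ring
    intro t
    have := is_const_of_deriv_eq_zero (fun s => (hd s).differentiableAt) (fun s => (hd s).deriv) t 0
    simpa [hY0, hZ0] using this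
  have hYW : ∀ t, 0 ≤ t → Y t * (Y t)⁻¹ = 1 := fun t ht =>
    mul_nonsing_inv _ ((isUnit_iff_isUnit_det _).1 (hU t ht))
  have hWY : ∀ t, 0 ≤ t → ((Y t)⁻¹)ᵀ * (Y t)ᵀ = 1 := fun t ht => by
    rw [← transpose_mul, hYW t ht, transpose_one]
  have hX : ∀ t, 0 ≤ t → (Z t * (Y t)⁻¹).PosSemidef := by
    intro t ht
    have h : ((Y t)ᵀ * Z t).PosSemidef := by
      refine .of_dotProduct_nonneg ?_ fun v => ?_
      · rw [transpose_mul, transpose_transpose]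
        exact (sub_eq_zero.1 (hsymm t)).symm
      · have h := hamiltonian_flow_dotProduct_monotone hM hQ hY hZ v ht
        rw [← mulVec_mulVec, dotProduct_mulVec, vecMul_transpose]
        simpa [hZ0] using h
    have h' := h.conjTranspose_mul_mul_same (Y t)⁻¹
    rwa [conjTranspose_eq_transpose_of_trivial, ← Matrix.mul_assoc, hWY t ht, Matrix.one_mul] at h'
  refine ⟨fun t => Z t * (Y t)⁻¹, by simp [hZ0], fun t ht => ?_, hX, fun t ht => ?_⟩
  · refine ((hZ t).mul ((hY t).matrix_inv (hU t ht))).congr_deriv ?_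
    -- With `Y⁻¹` abstracted to a right inverse `W`, this is an identity in a noncommutative ring.
    have e : ∀ W : Matrix (Fin n) (Fin n) ℝ, Y t * W = 1 →
        (Q * Y t + Aᵀ * Z t) * W + Z t * -(W * (-A * Y t + M * Z t) * W)
        = Z t * W * A + Aᵀ * (Z t * W) - Z t * W * M * (Z t * W) + Q := by
      intro W hW
      have e1 : (Q * Y t + Aᵀ * Z t) * W + Z t * -(W * (-A * Y t + M * Z t) * W)
          = Q * (Y t * W) + Aᵀ * (Z t * W) + Z t * W * A * (Y t * W)
            - Z t * W * M * (Z t * W) := by noncomm_ring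
      rw [e1, hW]
      noncomm_ring
    exact e _ (hYW t ht)
  · have h := hQ.conjTranspose_mul_mul_same (Y t)⁻¹
    have hXT := Matrix.IsSymm.of_posSemidef (hX t ht)
    have e : ∀ W : Matrix (Fin n) (Fin n) ℝ, Y t * W = 1 → Wᵀ * (Y t)ᵀ = 1 → (Z t * W)ᵀ = Z t * W →
        Wᵀ * Q * W = Z t * W * A + Aᵀ * (Z t * W) - Z t * W * M * (Z t * W) + Q := by
      intro W hW hW' hZW
      rw [transpose_mul] at hZW
      have e1 : Wᵀ * ((Y t)ᵀ * Q * Y t + (Z t)ᵀ * A * Y t + (Y t)ᵀ * Aᵀ * Z t - (Z t)ᵀ * M * Z t)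
          * W = (Wᵀ * (Y t)ᵀ) * Q * (Y t * W) + (Wᵀ * (Z t)ᵀ) * A * (Y t * W)
            + (Wᵀ * (Y t)ᵀ) * Aᵀ * (Z t * W) - (Wᵀ * (Z t)ᵀ) * M * (Z t * W) := by noncomm_ring
      rw [hham, hW, hW', hZW] at e1
      rw [e1]
      noncomm_ring
    rwa [conjTranspose_eq_transpose_of_trivial, e _ (hYW t ht) (hWY t ht) hXT] at h

end RiccatiFlow

/-! ### Uniqueness, invariance and limits of matrix flows. -/

section LinearODE

attribute [local instance] Matrix.linftyOpNormedRing Matrix.linftyOpNormedAlgebra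

/-- Grönwall's inequality. It serves both for the difference of two Riccati solutions and for the
product of a solution with a fixed matrix. -/
theorem eq_zero_of_hasDerivWithinAt_linear {n : ℕ} {D K L : ℝ → Matrix (Fin n) (Fin n) ℝ}
    (h0 : D 0 = 0) (hK : ContinuousOn K (Set.Ici 0)) (hL : ContinuousOn L (Set.Ici 0))
    (hD : ∀ t, 0 ≤ t → HasDerivWithinAt D (D t * K t + L t * D t) (Set.Ici 0) t)
    {t : ℝ} (ht : 0 ≤ t) : D t = 0 := by
  obtain ⟨k, hk⟩ := isCompact_Icc.exists_bound_of_continuousOn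
    (hK.mono (Set.Icc_subset_Ici_self : Set.Icc 0 t ⊆ _))
  obtain ⟨l, hl⟩ := isCompact_Icc.exists_bound_of_continuousOn
    (hL.mono (Set.Icc_subset_Ici_self : Set.Icc 0 t ⊆ _))
  refine eq_zero_of_abs_deriv_le_mul_abs_self_of_eq_zero_right (f := D) (a := 0) (b := t)
    (f' := fun t => D t * K t + L t * D t) (K := k + l)
    (fun s hs => (hD s hs.1).continuousWithinAt.mono Set.Icc_subset_Ici_self)
    (fun s hs => (hD s hs.1).mono (Set.Ici_subset_Ici.2 hs.1)) h0 (fun s hs => ?_) t ⟨ht, le_rfl⟩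
  have hs' : s ∈ Set.Icc 0 t := ⟨hs.1, hs.2.le⟩
  calc ‖D s * K s + L s * D s‖ ≤ ‖D s‖ * ‖K s‖ + ‖L s‖ * ‖D s‖ :=
        (norm_add_le _ _).trans (add_le_add (norm_mul_le _ _) (norm_mul_le _ _))
    _ ≤ ‖D s‖ * k + l * ‖D s‖ := by
        gcongr
        exacts [hk s hs', hl s hs']
    _ = (k + l) * ‖D s‖ := by ring

/-- Since `X M X - Y M Y = (X - Y) M X + Y M (X - Y)`, the difference solves a homogeneous linear
equation. -/
theorem riccati_flow_unique {n : ℕ} {A A' M Q : Matrix (Fin n) (Fin n) ℝ}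
    {X Y : ℝ → Matrix (Fin n) (Fin n) ℝ} (h0 : X 0 = Y 0)
    (hX : ∀ t, 0 ≤ t →
      HasDerivWithinAt X (X t * A + A' * X t - X t * M * X t + Q) (Set.Ici 0) t)
    (hY : ∀ t, 0 ≤ t →
      HasDerivWithinAt Y (Y t * A + A' * Y t - Y t * M * Y t + Q) (Set.Ici 0) t) :
    Set.EqOn X Y (Set.Ici 0) := by
  intro t ht
  have hXc : ContinuousOn X (Set.Ici 0) := fun t ht => (hX t ht).continuousWithinAt
  have hYc : ContinuousOn Y (Set.Ici 0) := fun t ht => (hY t ht).continuousWithinAt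
  refine sub_eq_zero.1 (eq_zero_of_hasDerivWithinAt_linear (D := fun t => X t - Y t)
    (K := fun t => A - M * X t) (L := fun t => A' - Y t * M) (by simp [h0])
    (continuousOn_const.sub (continuousOn_const.mul hXc))
    (continuousOn_const.sub (hYc.mul continuousOn_const)) (fun s hs => ?_) ht)
  refine ((hX s hs).sub (hY s hs)).congr_deriv ?_
  noncomm_ring

/-- The columns of `N` span an `A`-invariant subspace of `ker Q`, so `X N` solves a homogeneous
linear equation and starts at `0`. -/
theorem riccati_flow_mul_eq_zero {n : ℕ} {A A' M Q N K : Matrix (Fin n) (Fin n) ℝ}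
    {X : ℝ → Matrix (Fin n) (Fin n) ℝ} (h0 : X 0 = 0)
    (hX : ∀ t, 0 ≤ t →
      HasDerivWithinAt X (X t * A + A' * X t - X t * M * X t + Q) (Set.Ici 0) t)
    (hQ : Q * N = 0) (hA : A * N = N * K) {t : ℝ} (ht : 0 ≤ t) : X t * N = 0 := by
  have hXc : ContinuousOn X (Set.Ici 0) := fun t ht => (hX t ht).continuousWithinAt
  refine eq_zero_of_hasDerivWithinAt_linear (D := fun t => X t * N) (K := fun _ => K)
    (L := fun t => A' - X t * M) (by simp [h0]) continuousOn_const
    (continuousOn_const.sub (hXc.mul continuousOn_const)) (fun s hs => ?_) ht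
  refine ((hX s hs).mul_const N).congr_deriv ?_
  have e : (X s * A + A' * X s - X s * M * X s + Q) * N
    = X s * (A * N) + (A' - X s * M) * (X s * N) + Q * N := by noncomm_ring
  rw [e, hA, hQ, add_zero, Matrix.mul_assoc (X s) N]

/-- By the mean value theorem on `[t, t + 1]`, `f'` takes the value `f (t + 1) - f t → 0` at points
tending to infinity. -/
theorem eq_zero_of_tendsto_of_tendsto_deriv {f f' : ℝ → ℝ} {c l : ℝ}
    (hf : ∀ t, 0 ≤ t → HasDerivAt f (f' t) t) (hc : Tendsto f atTop (𝓝 c))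
    (hl : Tendsto f' atTop (𝓝 l)) : l = 0 := by
  have h : ∀ t : ℝ, ∃ ξ, t ≤ ξ ∧ (0 ≤ t → f' ξ = f (t + 1) - f t) := by
    intro t
    by_cases ht : 0 ≤ t
    · obtain ⟨ξ, hξ, h⟩ := exists_hasDerivAt_eq_slope f f' (lt_add_one t)
        (fun s hs => (hf s (ht.trans hs.1)).continuousAt.continuousWithinAt)
        (fun s hs => hf s (ht.trans hs.1.le))
      exact ⟨ξ, hξ.1.le, fun _ => by simpa using h⟩
    · exact ⟨t, le_rfl, fun h => absurd h ht⟩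
  choose ξ hξ h using h
  have h1 : Tendsto (fun t => f (t + 1) - f t) atTop (𝓝 (c - c)) :=
    (hc.comp (tendsto_atTop_add_const_right _ _ tendsto_id)).sub hc
  have h2 : Tendsto (fun t => f' (ξ t)) atTop (𝓝 l) :=
    hl.comp (tendsto_atTop_mono hξ tendsto_id)
  rw [sub_self] at h1
  refine tendsto_nhds_unique (h2.congr' ?_) h1
  filter_upwards [eventually_ge_atTop 0] with t ht using h t ht

theorem Matrix.apply_eq_polarization {n : Type*} [Fintype n] [DecidableEq n] {X : Matrix n n ℝ}
    (hX : Xᵀ = X) (i j : n) :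
    X i j = ((Pi.single i 1 + Pi.single j 1) ⬝ᵥ (X *ᵥ (Pi.single i 1 + Pi.single j 1))
      - Pi.single i 1 ⬝ᵥ (X *ᵥ Pi.single i 1) - Pi.single j 1 ⬝ᵥ (X *ᵥ Pi.single j 1)) / 2 := by
  have h : X j i = X i j := congrFun (congrFun hX i) j
  simp [mulVec_add, add_dotProduct, dotProduct_add, h]
  ring

/-- Each quadratic form is monotone and bounded, hence convergent; polarization recovers the
entries. -/
theorem exists_tendsto_of_monotone_posSemidef {n : ℕ} {X X' : ℝ → Matrix (Fin n) (Fin n) ℝ}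
    (hX : ∀ t, 0 ≤ t → HasDerivAt X (X' t) t) (hpos : ∀ t, 0 ≤ t → (X t).PosSemidef)
    (hpos' : ∀ t, 0 ≤ t → (X' t).PosSemidef)
    (hbdd : ∀ x : Fin n → ℝ, ∃ C, ∀ t, 0 ≤ t → x ⬝ᵥ (X t *ᵥ x) ≤ C) :
    ∃ X₁, Tendsto X atTop (𝓝 X₁) ∧ X₁.PosSemidef := by
  have hd : ∀ (x : Fin n → ℝ) t, 0 ≤ t →
      HasDerivAt (fun s => x ⬝ᵥ (X s *ᵥ x)) (x ⬝ᵥ (X' t *ᵥ x)) t := by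
    intro x t ht
    simpa using (hasDerivAt_const t x).matrix_dotProduct ((hX t ht).matrix_mulVec x)
  have hmono : ∀ x : Fin n → ℝ, MonotoneOn (fun s => x ⬝ᵥ (X s *ᵥ x)) (Set.Ici 0) := by
    intro x
    refine monotoneOn_of_deriv_nonneg (convex_Ici 0)
      (fun t ht => (hd x t ht).continuousAt.continuousWithinAt) (fun t ht => ?_) (fun t ht => ?_)
    all_goals
      rw [interior_Ici] at ht
      have h := hd x t (le_of_lt ht)
    · exact h.differentiableAt.differentiableWithinAt
    · rw [h.deriv]
      exact (hpos' t (le_of_lt ht)).dotProduct_nonneg x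
  have hlim : ∀ x : Fin n → ℝ, ∃ c, Tendsto (fun s => x ⬝ᵥ (X s *ᵥ x)) atTop (𝓝 c) := by
    intro x
    obtain ⟨C, hC⟩ := hbdd x
    -- Freezing the flow at negative times makes the form monotone on all of `ℝ`.
    have hm : Monotone fun s => x ⬝ᵥ (X (max s 0) *ᵥ x) := fun s t hst =>
      hmono x (Set.mem_Ici.2 (le_max_right _ _)) (Set.mem_Ici.2 (le_max_right _ _)) (max_le_max_right _ hst)
    refine ⟨_, (tendsto_atTop_ciSup hm ⟨C, ?_⟩).congr' ?_⟩
    · rintro _ ⟨s, rfl⟩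
      exact hC _ (le_max_right _ _)
    · filter_upwards [eventually_ge_atTop 0] with t ht
      rw [max_eq_left ht]
  choose q hq using hlim
  set X₁ : Matrix (Fin n) (Fin n) ℝ := Matrix.of fun i j =>
    (q (Pi.single i 1 + Pi.single j 1) - q (Pi.single i 1) - q (Pi.single j 1)) / 2 with hX₁
  have ht : Tendsto X atTop (𝓝 X₁) := by
    refine tendsto_pi_nhds.2 fun i => tendsto_pi_nhds.2 fun j => ?_
    refine ((((hq _).sub (hq _)).sub (hq _)).div_const 2).congr' ?_
    filter_upwards [eventually_ge_atTop 0] with t ht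
    exact (Matrix.apply_eq_polarization (Matrix.IsSymm.of_posSemidef (hpos t ht)) i j).symm
  have hform : ∀ x : Fin n → ℝ,
      Tendsto (fun s => x ⬝ᵥ (X s *ᵥ x)) atTop (𝓝 (x ⬝ᵥ (X₁ *ᵥ x))) := by
    intro x
    have hc : Continuous fun Y : Matrix (Fin n) (Fin n) ℝ => x ⬝ᵥ (Y *ᵥ x) := by fun_prop
    exact (hc.tendsto X₁).comp ht
  refine ⟨X₁, ht, .of_dotProduct_nonneg ?_ fun x => ?_⟩
  · ext i j
    simp only [hX₁, transpose_apply, of_apply]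
    rw [add_comm (Pi.single j (1 : ℝ) : Fin n → ℝ)]
    ring
  · refine ge_of_tendsto (hform x) ?_
    filter_upwards [eventually_ge_atTop 0] with t ht using (hpos t ht).dotProduct_nonneg x

theorem deriv_limit_eq_zero {n : ℕ} {X : ℝ → Matrix (Fin n) (Fin n) ℝ}
    {F : Matrix (Fin n) (Fin n) ℝ → Matrix (Fin n) (Fin n) ℝ} {X₁ : Matrix (Fin n) (Fin n) ℝ}
    (hF : Continuous F) (hX : ∀ t, 0 ≤ t → HasDerivAt X (F (X t)) t)
    (ht : Tendsto X atTop (𝓝 X₁)) : F X₁ = 0 := by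
  have h1 : Tendsto (fun t => F (X t)) atTop (𝓝 (F X₁)) := (hF.tendsto _).comp ht
  ext i j
  exact eq_zero_of_tendsto_of_tendsto_deriv
    (fun t h => hasDerivAt_pi.1 (hasDerivAt_pi.1 (hX t h) i) j)
    (tendsto_pi_nhds.1 (tendsto_pi_nhds.1 ht i) j) (tendsto_pi_nhds.1 (tendsto_pi_nhds.1 h1 i) j)

end LinearODE

/-! ### Pseudo-inverse algebra and completion of squares. -/

section Algebra

variable {n m : ℕ} {A : Matrix (Fin n) (Fin n) ℝ} {B : Matrix (Fin n) (Fin m) ℝ}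
  {Q : Matrix (Fin n) (Fin n) ℝ} {S : Matrix (Fin n) (Fin m) ℝ} {R : Matrix (Fin m) (Fin m) ℝ}

theorem pinv_transpose_of_symm (hR : Rᵀ = R) : (pinv R)ᵀ = pinv R := by
  have h := pinv_spec R
  refine IsMoorePenrose.unique (M := R) ⟨?_, ?_, ?_, ?_⟩ h
  · simpa only [transpose_mul, hR, Matrix.mul_assoc] using congrArg transpose h.mul_mul_self
  · simpa only [transpose_mul, hR, Matrix.mul_assoc] using congrArg transpose h.inv_mul_mul
  · have := h.symm_right
    rw [transpose_mul, hR] at this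
    rw [transpose_mul, transpose_transpose, hR, this]
  · have := h.symm_left
    rw [transpose_mul, hR] at this
    rw [transpose_mul, transpose_transpose, hR, this]

theorem pinv_posSemidef (hR : R.PosSemidef) : (pinv R).PosSemidef := by
  have h := hR.conjTranspose_mul_mul_same (pinv R)
  rwa [conjTranspose_eq_transpose_of_trivial,
    pinv_transpose_of_symm (Matrix.IsSymm.of_posSemidef hR), (pinv_spec R).inv_mul_mul] at h

theorem mul_kerProj_self : R * kerProj R = 0 := by
  rw [kerProj, Matrix.mul_sub, Matrix.mul_one, ← Matrix.mul_assoc, (pinv_spec R).mul_mul_self,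
    sub_self]

theorem kerProj_mulVec_eq {z : Fin m → ℝ} (hz : R *ᵥ z = 0) : kerProj R *ᵥ z = z := by
  rw [kerProj, sub_mulVec, one_mulVec, ← mulVec_mulVec, hz, mulVec_zero, sub_zero]

/-- The range of `kerProj R` is `ker R`. In this form the constraint is a linear matrix equation,
which passes to limits. -/
theorem ker_le_ker_iff_mul_kerProj {k : ℕ} {F : Matrix (Fin k) (Fin m) ℝ} :
    LinearMap.ker R.mulVecLin ≤ LinearMap.ker F.mulVecLin ↔ F * kerProj R = 0 := by
  constructor
  · intro h
    refine Matrix.ext_of_mulVec_single fun i => ?_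
    have h' : kerProj R *ᵥ Pi.single i 1 ∈ LinearMap.ker R.mulVecLin := by
      rw [LinearMap.mem_ker, mulVecLin_apply, mulVec_mulVec, mul_kerProj_self, zero_mulVec]
    have h2 := h h'
    rw [LinearMap.mem_ker, mulVecLin_apply, mulVec_mulVec] at h2
    rw [h2, zero_mulVec]
  · intro h z hz
    rw [LinearMap.mem_ker, mulVecLin_apply] at hz ⊢
    rw [← kerProj_mulVec_eq hz, mulVec_mulVec, h, zero_mulVec]

theorem mul_pinv_mul_of_mul_kerProj {k : ℕ} {F : Matrix (Fin k) (Fin m) ℝ}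
    (h : F * kerProj R = 0) : F * pinv R * R = F := by
  rw [kerProj, Matrix.mul_sub, Matrix.mul_one, sub_eq_zero] at h
  rw [Matrix.mul_assoc, ← h]

theorem fromBlocks_form (x : Fin n → ℝ) (u : Fin m → ℝ) :
    Sum.elim x u ⬝ᵥ (fromBlocks Q S Sᵀ R *ᵥ Sum.elim x u)
      = x ⬝ᵥ (Q *ᵥ x) + 2 * (x ⬝ᵥ (S *ᵥ u)) + u ⬝ᵥ (R *ᵥ u) := by
  rw [fromBlocks_mulVec, sumElim_dotProduct_sumElim]
  simp only [Sum.elim_comp_inl, Sum.elim_comp_inr, dotProduct_add]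
  rw [dotProduct_mulVec u Sᵀ, vecMul_transpose, dotProduct_comm (S *ᵥ u)]
  ring

theorem posSemidef_of_fromBlocks₁₁ (h : (fromBlocks Q S Sᵀ R).PosSemidef) : Q.PosSemidef :=
  h.submatrix Sum.inl

theorem posSemidef_of_fromBlocks₂₂ (h : (fromBlocks Q S Sᵀ R).PosSemidef) : R.PosSemidef :=
  h.submatrix Sum.inr

/-- If `R z = 0`, the form of `Π` vanishes at `(0, z)`; by semidefiniteness `Π (0, z) = 0`, whose
first block is `S z`. -/
theorem mul_kerProj_of_fromBlocks (h : (fromBlocks Q S Sᵀ R).PosSemidef) :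
    S * kerProj R = 0 := by
  rw [← ker_le_ker_iff_mul_kerProj]
  intro z hz
  rw [LinearMap.mem_ker, mulVecLin_apply] at hz ⊢
  have h1 : Sum.elim (0 : Fin n → ℝ) z ⬝ᵥ (fromBlocks Q S Sᵀ R *ᵥ Sum.elim 0 z) = 0 := by
    rw [fromBlocks_form]
    simp [hz]
  have h2 := (h.dotProduct_mulVec_zero_iff (Sum.elim 0 z)).1 (by simpa using h1)
  rw [fromBlocks_mulVec] at h2
  simpa [funext_iff] using congrArg (fun f => f ∘ Sum.inl) h2

theorem riccati_eq (hR : Rᵀ = R) (X : Matrix (Fin n) (Fin n) ℝ) :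
    riccati A B Q S R X = X * (A - B * pinv R * Sᵀ) + (A - B * pinv R * Sᵀ)ᵀ * X
      - X * (B * pinv R * Bᵀ) * X + (Q - S * pinv R * Sᵀ) := by
  simp only [riccati, transpose_sub, transpose_mul, transpose_transpose,
    pinv_transpose_of_symm hR, Matrix.add_mul, Matrix.mul_add, Matrix.sub_mul, Matrix.mul_sub,
    Matrix.mul_assoc]
  abel

theorem control_term_posSemidef (hR : R.PosSemidef) : (B * pinv R * Bᵀ).PosSemidef := by
  simpa [conjTranspose_eq_transpose_of_trivial] using
    (pinv_posSemidef hR).mul_mul_conjTranspose_same B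

/-- A generalised Schur complement: it is the form of `Π` evaluated at `u = -R† Sᵀ x`. -/
theorem reduced_weight_posSemidef (h : (fromBlocks Q S Sᵀ R).PosSemidef) :
    (Q - S * pinv R * Sᵀ).PosSemidef := by
  have hR := Matrix.IsSymm.of_posSemidef (posSemidef_of_fromBlocks₂₂ h)
  have hQ := Matrix.IsSymm.of_posSemidef (posSemidef_of_fromBlocks₁₁ h)
  refine .of_dotProduct_nonneg ?_ fun x => ?_
  · simp only [transpose_sub, transpose_mul, transpose_transpose, pinv_transpose_of_symm hR, hQ,
      Matrix.mul_assoc]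
  · have h1 := h.dotProduct_nonneg (Sum.elim x (-((pinv R * Sᵀ) *ᵥ x)))
    rw [fromBlocks_form] at h1
    have e : ((pinv R * Sᵀ) *ᵥ x) ⬝ᵥ (R *ᵥ ((pinv R * Sᵀ) *ᵥ x))
        = x ⬝ᵥ ((S * pinv R * Sᵀ) *ᵥ x) := by
      rw [mulVec_mulVec, ← vecMul_transpose, ← dotProduct_mulVec, mulVec_mulVec]
      congr 2
      rw [transpose_mul, transpose_transpose, pinv_transpose_of_symm hR]
      calc S * pinv R * (R * (pinv R * Sᵀ)) = S * (pinv R * R * pinv R) * Sᵀ := by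
            simp only [Matrix.mul_assoc]
        _ = _ := by rw [(pinv_spec R).inv_mul_mul]
    simp only [mulVec_neg, dotProduct_neg, neg_dotProduct, neg_neg, e] at h1
    rw [mulVec_mulVec, ← Matrix.mul_assoc] at h1
    rw [sub_mulVec, dotProduct_sub]
    linarith

/-- The constraint gives `(S + X B) R† R = S + X B`, which lets the terms linear in `u` be absorbed
into the square even when `R` is singular. -/
theorem completion_of_squares (hR : Rᵀ = R) {X : Matrix (Fin n) (Fin n) ℝ} (hX : Xᵀ = X)
    (hk : (S + X * B) * kerProj R = 0) (x : Fin n → ℝ) (u : Fin m → ℝ) :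
    x ⬝ᵥ (Q *ᵥ x) + 2 * (x ⬝ᵥ (S *ᵥ u)) + u ⬝ᵥ (R *ᵥ u) + 2 * (x ⬝ᵥ (X *ᵥ (A *ᵥ x + B *ᵥ u)))
      = x ⬝ᵥ (riccati A B Q S R X *ᵥ x)
        + (u + (pinv R * (Sᵀ + Bᵀ * X)) *ᵥ x) ⬝ᵥ (R *ᵥ (u + (pinv R * (Sᵀ + Bᵀ * X)) *ᵥ x)) := by
  set F := S + X * B with hF
  have hFT : Sᵀ + Bᵀ * X = Fᵀ := by rw [hF, transpose_add, transpose_mul, hX]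
  have hP := pinv_transpose_of_symm hR
  have h1 : F * pinv R * R = F := mul_pinv_mul_of_mul_kerProj hk
  have h2 : R * (pinv R * Fᵀ) = Fᵀ := by
    simpa only [transpose_mul, hR, hP] using congrArg transpose h1
  have e0 : R *ᵥ (u + (pinv R * Fᵀ) *ᵥ x) = R *ᵥ u + Fᵀ *ᵥ x := by
    rw [mulVec_add, mulVec_mulVec, h2]
  have e1 : ((pinv R * Fᵀ) *ᵥ x) ⬝ᵥ (R *ᵥ u) = x ⬝ᵥ (F *ᵥ u) := by
    rw [← vecMul_transpose, ← dotProduct_mulVec, mulVec_mulVec, transpose_mul, transpose_transpose,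
      hP, h1]
  have e2 : ((pinv R * Fᵀ) *ᵥ x) ⬝ᵥ (Fᵀ *ᵥ x) = x ⬝ᵥ ((F * pinv R * Fᵀ) *ᵥ x) := by
    rw [← vecMul_transpose, ← dotProduct_mulVec, mulVec_mulVec, transpose_mul, transpose_transpose,
      hP]
  have e3 : u ⬝ᵥ (Fᵀ *ᵥ x) = x ⬝ᵥ (F *ᵥ u) := by
    rw [dotProduct_mulVec, vecMul_transpose, dotProduct_comm]
  have e4 : x ⬝ᵥ ((Aᵀ * X) *ᵥ x) = x ⬝ᵥ ((X * A) *ᵥ x) := by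
    rw [dotProduct_mulVec, ← mulVec_transpose, transpose_mul, transpose_transpose, hX,
      dotProduct_comm]
  have e5 : x ⬝ᵥ (F *ᵥ u) = x ⬝ᵥ (S *ᵥ u) + x ⬝ᵥ ((X * B) *ᵥ u) := by
    rw [hF, add_mulVec, dotProduct_add]
  rw [hFT, e0, riccati, hFT, ← hF]
  simp only [add_dotProduct, dotProduct_add, e1, e2, e3, add_mulVec, sub_mulVec, dotProduct_sub,
    mulVec_add, e4, e5, mulVec_mulVec]
  ring

end Algebra

/-! ### The kernel constraint along the flow. -/

section Invariance

variable {n m : ℕ} {A : Matrix (Fin n) (Fin n) ℝ} {B : Matrix (Fin n) (Fin m) ℝ}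
  {Q : Matrix (Fin n) (Fin n) ℝ} {S : Matrix (Fin n) (Fin m) ℝ} {R : Matrix (Fin m) (Fin m) ℝ}

theorem Matrix.PosSemidef.mul_eq_zero_of_transpose_mul_mul {k : ℕ} {P : Matrix (Fin n) (Fin n) ℝ}
    (hP : P.PosSemidef) {N : Matrix (Fin n) (Fin k) ℝ} (h : Nᵀ * P * N = 0) : P * N = 0 := by
  refine Matrix.ext_of_mulVec_single fun i => ?_
  rw [zero_mulVec, ← mulVec_mulVec]
  refine (hP.dotProduct_mulVec_zero_iff _).1 ?_
  have e : ∀ w, (N *ᵥ Pi.single i 1) ⬝ᵥ w = Pi.single i 1 ⬝ᵥ (Nᵀ *ᵥ w) := fun w => by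
    rw [dotProduct_mulVec, vecMul_transpose]
  rw [star_trivial, e, mulVec_mulVec, mulVec_mulVec, h, zero_mulVec, dotProduct_zero]

theorem kerProj_mul_of_mul_eq_zero {k l : ℕ} {X : Matrix (Fin k) (Fin k) ℝ}
    {Y : Matrix (Fin k) (Fin l) ℝ} (h : X * Y = 0) : kerProj X * Y = Y := by
  rw [kerProj, Matrix.sub_mul, Matrix.mul_assoc, h, Matrix.mul_zero, sub_zero, Matrix.one_mul]

/-- The kernel of a symmetric solution of the constrained Riccati equation is invariant, is
annihilated by the reduced weight, and contains the unweighted input directions. -/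
theorem IsCGCARE.kerProj_invariance (hPi : (fromBlocks Q S Sᵀ R).PosSemidef)
    {X : Matrix (Fin n) (Fin n) ℝ} (hX : Xᵀ = X) (h : IsCGCARE A B Q S R X) :
    (Q - S * pinv R * Sᵀ) * kerProj X = 0 ∧
      (A - B * pinv R * Sᵀ) * kerProj X = kerProj X * ((A - B * pinv R * Sᵀ) * kerProj X) ∧
      kerProj X * (B * kerProj R) = B * kerProj R := by
  have hR := Matrix.IsSymm.of_posSemidef (posSemidef_of_fromBlocks₂₂ hPi)
  have h0 := h.1
  rw [riccati_eq hR] at h0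
  generalize hA₀ : A - B * pinv R * Sᵀ = A₀ at *
  generalize hM : B * pinv R * Bᵀ = M at *
  have hpos := reduced_weight_posSemidef hPi
  generalize Q - S * pinv R * Sᵀ = Q₀ at *
  generalize hN : kerProj X = N
  have hXN : X * N = 0 := hN ▸ mul_kerProj_self
  have hNX : Nᵀ * X = 0 := by
    simpa only [transpose_mul, hX, transpose_zero] using congrArg transpose hXN
  have hric : X * (A₀ * N) + Q₀ * N = 0 := by
    have e : (X * A₀ + A₀ᵀ * X - X * M * X + Q₀) * N
      = X * (A₀ * N) + A₀ᵀ * (X * N) - X * M * (X * N) + Q₀ * N := by noncomm_ring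
    rw [h0, hXN] at e
    simpa using e.symm
  -- Multiplying by `Nᵀ` on the left removes the term in `X` and leaves `Nᵀ Q₀ N = 0`.
  have hQN : Q₀ * N = 0 := by
    refine hpos.mul_eq_zero_of_transpose_mul_mul ?_
    have e := congrArg (Nᵀ * ·) hric
    simpa only [Matrix.mul_add, ← Matrix.mul_assoc, hNX, Matrix.zero_mul, Matrix.mul_zero,
      zero_add] using e
  have hXAN : X * (A₀ * N) = 0 := by simpa [hQN] using hric
  have hXB : X * (B * kerProj R) = 0 := by
    have e := ker_le_ker_iff_mul_kerProj.1 h.2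
    rwa [Matrix.add_mul, mul_kerProj_of_fromBlocks hPi, zero_add, Matrix.mul_assoc] at e
  refine ⟨hQN, ?_, ?_⟩
  · rw [← hN] at hXAN ⊢
    exact (kerProj_mul_of_mul_eq_zero hXAN).symm
  · rw [← hN]
    exact kerProj_mul_of_mul_eq_zero hXB

theorem IsForwardRiccatiSolution.hasDerivWithinAt {X : ℝ → Matrix (Fin n) (Fin n) ℝ}
    (h : IsForwardRiccatiSolution A B Q S R X) {t : ℝ} (ht : 0 ≤ t) :
    HasDerivWithinAt X (riccati A B Q S R (X t)) (Set.Ici 0) t :=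
  hasDerivWithinAt_pi.2 fun i => hasDerivWithinAt_pi.2 fun j => h.2 t ht i j

/-- The forward Riccati equation has a unique solution; it is positive semidefinite and
nondecreasing, and it satisfies the kernel constraint at all times. -/
theorem exists_forwardRiccatiSolution (hPi : (fromBlocks Q S Sᵀ R).PosSemidef)
    (hsol : ∃ X : Matrix (Fin n) (Fin n) ℝ, X.IsSymm ∧ IsCGCARE A B Q S R X) :
    ∃ X : ℝ → Matrix (Fin n) (Fin n) ℝ, IsForwardRiccatiSolution A B Q S R X ∧
      (∀ Y, IsForwardRiccatiSolution A B Q S R Y → Set.EqOn Y X (Set.Ici 0)) ∧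
      (∀ t, 0 ≤ t → HasDerivAt X (riccati A B Q S R (X t)) t) ∧
      (∀ t, 0 ≤ t → (X t).PosSemidef) ∧
      (∀ t, 0 ≤ t → (riccati A B Q S R (X t)).PosSemidef) ∧
      (∀ t, 0 ≤ t → (S + X t * B) * kerProj R = 0) := by
  have hRpos := posSemidef_of_fromBlocks₂₂ hPi
  have hR := Matrix.IsSymm.of_posSemidef hRpos
  obtain ⟨X, hX0, hX, hpos, hpos'⟩ := exists_riccati_flow (A := A - B * pinv R * Sᵀ)
    (control_term_posSemidef (B := B) hRpos) (reduced_weight_posSemidef hPi)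
  simp only [← riccati_eq hR] at hX hpos'
  have hfw : IsForwardRiccatiSolution A B Q S R X := ⟨hX0, fun t ht i j =>
    (hasDerivAt_pi.1 (hasDerivAt_pi.1 (hX t ht) i) j).hasDerivWithinAt⟩
  refine ⟨X, hfw, fun Y hY => ?_, hX, hpos, hpos', fun t ht => ?_⟩
  · refine riccati_flow_unique (hY.1.trans hX0.symm)
      (fun t ht => (riccati_eq hR (Y t)) ▸ hY.hasDerivWithinAt ht)
      (fun t ht => (riccati_eq hR (X t)) ▸ hfw.hasDerivWithinAt ht)
  -- With `N = kerProj Xs` one gets `X t * N = 0`; as `B G = N B G`, also `X t * B * G = 0`.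
  · obtain ⟨Xs, hs, hc⟩ := hsol
    obtain ⟨h1, h2, h3⟩ := hc.kerProj_invariance hPi hs
    have h := riccati_flow_mul_eq_zero hX0
      (fun t ht => (riccati_eq hR (X t)) ▸ hfw.hasDerivWithinAt ht) h1 h2 ht
    rw [Matrix.add_mul, mul_kerProj_of_fromBlocks hPi, zero_add, Matrix.mul_assoc, ← h3,
      ← Matrix.mul_assoc, h, Matrix.zero_mul]

end Invariance

/-! ### Absolutely continuous functions. -/

section AbsoluteContinuity

theorem AbsolutelyContinuousOnInterval.const (c a b : ℝ) :
    AbsolutelyContinuousOnInterval (fun _ => c) a b :=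
  (contDiffOn_const (c := c)).absolutelyContinuousOnInterval

theorem AbsolutelyContinuousOnInterval.sum {ι : Type*} (s : Finset ι) {f : ι → ℝ → ℝ} {a b : ℝ}
    (h : ∀ i ∈ s, AbsolutelyContinuousOnInterval (f i) a b) :
    AbsolutelyContinuousOnInterval (fun t => ∑ i ∈ s, f i t) a b := by
  classical
  induction s using Finset.induction_on with
  | empty => simpa using AbsolutelyContinuousOnInterval.const 0 a b
  | insert i s hi ih =>
    simp only [Finset.sum_insert hi]
    exact (h i (Finset.mem_insert_self i s)).add
      (ih fun j hj => h j (Finset.mem_insert_of_mem hj))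

theorem AbsolutelyContinuousOnInterval.congr {f g : ℝ → ℝ} {a b : ℝ}
    (hf : AbsolutelyContinuousOnInterval f a b) (h : Set.EqOn f g (Set.uIcc a b)) :
    AbsolutelyContinuousOnInterval g a b := by
  rw [absolutelyContinuousOnInterval_iff] at hf ⊢
  intro ε hε
  obtain ⟨δ, hδ, H⟩ := hf ε hε
  refine ⟨δ, hδ, fun E hE hlt => ?_⟩
  have := H E hE hlt
  rwa [Finset.sum_congr rfl fun i hi => by
    rw [h (hE.1 i hi).1, h (hE.1 i hi).2]] at this

theorem absolutelyContinuousOnInterval_of_hasDerivAt {f f' : ℝ → ℝ} {a b : ℝ} (hab : a ≤ b)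
    (hf : ∀ t ∈ Set.Icc a b, HasDerivAt f (f' t) t) (hf' : ContinuousOn f' (Set.Icc a b)) :
    AbsolutelyContinuousOnInterval f a b := by
  obtain ⟨C, hC⟩ := isCompact_Icc.exists_bound_of_continuousOn hf'
  have h : LipschitzOnWith C.toNNReal f (Set.uIcc a b) := by
    rw [Set.uIcc_of_le hab]
    refine (convex_Icc a b).lipschitzOnWith_of_nnnorm_hasDerivWithin_le
      (fun t ht => (hf t ht).hasDerivWithinAt) fun t ht => ?_
    rw [← NNReal.coe_le_coe, coe_nnnorm]
    exact (hC t ht).trans (Real.le_coe_toNNReal C)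
  exact h.absolutelyContinuousOnInterval

/-- Controls are only locally `L²`, so trajectories are differentiable only almost everywhere; this
form of the fundamental theorem of calculus suffices for them. -/
theorem AbsolutelyContinuousOnInterval.intervalIntegrable_and_integral_eq {f f' : ℝ → ℝ} {a b : ℝ}
    (hf : AbsolutelyContinuousOnInterval f a b)
    (hf' : ∀ᵐ t, t ∈ Set.uIcc a b → HasDerivAt f (f' t) t) :
    IntervalIntegrable f' volume a b ∧ ∫ t in a..b, f' t = f b - f a := by
  have h : ∀ᵐ t, t ∈ Set.uIoc a b → deriv f t = f' t := by
    filter_upwards [hf'] with t ht hmem using (ht (Set.uIoc_subset_uIcc hmem)).deriv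
  refine ⟨hf.intervalIntegrable_deriv.congr_ae ?_, ?_⟩
  · exact (ae_restrict_iff' measurableSet_uIoc).2 h
  · rw [← hf.integral_deriv_eq_sub]
    exact (intervalIntegral.integral_congr_ae h).symm

end AbsoluteContinuity

/-! ### Regularity of trajectories. -/

section Trajectory

variable {n m : ℕ} {A : Matrix (Fin n) (Fin n) ℝ} {B : Matrix (Fin n) (Fin m) ℝ}
  {Q : Matrix (Fin n) (Fin n) ℝ} {S : Matrix (Fin n) (Fin m) ℝ} {R : Matrix (Fin m) (Fin m) ℝ}
  {x₀ : Fin n → ℝ} {u : ℝ → Fin m → ℝ} {x : ℝ → Fin n → ℝ}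

theorem IsL2Loc.integrableOn (hu : IsL2Loc u) (T : ℝ) : IntegrableOn u (Set.Icc 0 T) volume :=
  (hu T).integrable (by norm_num)

theorem MeasureTheory.IntegrableOn.mulVec {k l : ℕ} {f : ℝ → Fin l → ℝ} {s : Set ℝ}
    (hf : IntegrableOn f s volume) (F : Matrix (Fin k) (Fin l) ℝ) :
    IntegrableOn (fun t => F *ᵥ f t) s volume :=
  (LinearMap.toContinuousLinearMap F.mulVecLin).integrable_comp hf

theorem IsTrajectory.intervalIntegrable (h : IsTrajectory A B x₀ u x) {T : ℝ} (hT : 0 ≤ T) :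
    IntervalIntegrable (fun s => A *ᵥ x s + B *ᵥ u s) volume 0 T := by
  rw [intervalIntegrable_iff_integrableOn_Icc_of_le hT]
  have hx : IntegrableOn x (Set.Icc 0 T) volume :=
    (h.continuousOn.mono Set.Icc_subset_Ici_self).integrableOn_Icc
  exact (hx.mulVec A).add ((h.control.integrableOn T).mulVec B)

theorem intervalIntegral_apply {f : ℝ → Fin n → ℝ} {a b : ℝ}
    (hf : IntervalIntegrable f volume a b) (i : Fin n) :
    (∫ t in a..b, f t) i = ∫ t in a..b, f t i :=
  ((ContinuousLinearMap.proj (R := ℝ) (φ := fun _ : Fin n => ℝ) i).intervalIntegral_comp_comm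
    hf).symm

theorem IntervalIntegrable.apply {f : ℝ → Fin n → ℝ} {a b : ℝ}
    (hf : IntervalIntegrable f volume a b) (i : Fin n) :
    IntervalIntegrable (fun t => f t i) volume a b :=
  ⟨(ContinuousLinearMap.proj (R := ℝ) (φ := fun _ : Fin n => ℝ) i).integrable_comp hf.1,
    (ContinuousLinearMap.proj (R := ℝ) (φ := fun _ : Fin n => ℝ) i).integrable_comp hf.2⟩

theorem absolutelyContinuousOnInterval_primitive {f : ℝ → Fin n → ℝ} {T : ℝ}
    (hf : IntervalIntegrable f volume 0 T) (c : Fin n → ℝ) (i : Fin n) :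
    AbsolutelyContinuousOnInterval (fun t => (c + ∫ s in (0 : ℝ)..t, f s) i) 0 T := by
  refine ((AbsolutelyContinuousOnInterval.const (c i) 0 T).add
    ((hf.apply i).absolutelyContinuousOnInterval_intervalIntegral Set.left_mem_uIcc)).congr
    fun t ht => ?_
  have h : IntervalIntegrable f volume 0 t :=
    hf.mono_set (Set.uIcc_subset_uIcc Set.left_mem_uIcc ht)
  simp [intervalIntegral_apply h]

theorem IsTrajectory.absolutelyContinuousOnInterval (h : IsTrajectory A B x₀ u x) {T : ℝ}
    (hT : 0 ≤ T) (i : Fin n) : AbsolutelyContinuousOnInterval (fun t => x t i) 0 T := by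
  refine (absolutelyContinuousOnInterval_primitive (h.intervalIntegrable hT) x₀ i).congr
    fun t ht => ?_
  rw [Set.uIcc_of_le hT] at ht
  exact (congrFun (h.eq_integral t ht.1) i).symm

theorem IsTrajectory.ae_hasDerivAt (h : IsTrajectory A B x₀ u x) {T : ℝ} (hT : 0 ≤ T) :
    ∀ᵐ t, t ∈ Set.uIcc 0 T → HasDerivAt x (A *ᵥ x t + B *ᵥ u t) t := by
  -- The integral equation holds only for `t ≥ 0`, so it determines no two-sided derivative at `0`.
  have h0 : ∀ᵐ t : ℝ, t ≠ 0 := by simp [ae_iff]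
  filter_upwards [(h.intervalIntegrable hT).ae_hasDerivAt_integral, h0] with t ht ht0 hmem
  have hpos : 0 < t := lt_of_le_of_ne (by rw [Set.uIcc_of_le hT] at hmem; exact hmem.1) ht0.symm
  refine ((ht hmem 0 Set.left_mem_uIcc).const_add x₀).congr_of_eventuallyEq ?_
  filter_upwards [Ioi_mem_nhds hpos] with s hs using h.eq_integral s (le_of_lt hs)

end Trajectory

/-! ### Energy balance and cost estimates. -/

section Energy

variable {n m : ℕ} {A : Matrix (Fin n) (Fin n) ℝ} {B : Matrix (Fin n) (Fin m) ℝ}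
  {Q : Matrix (Fin n) (Fin n) ℝ} {S : Matrix (Fin n) (Fin m) ℝ} {R : Matrix (Fin m) (Fin m) ℝ}
  {x₀ : Fin n → ℝ} {u : ℝ → Fin m → ℝ} {x : ℝ → Fin n → ℝ}

theorem continuous_riccati : Continuous (riccati A B Q S R) := by
  unfold riccati
  fun_prop

theorem AbsolutelyContinuousOnInterval.quadratic_form {y : ℝ → Fin n → ℝ}
    {P : ℝ → Matrix (Fin n) (Fin n) ℝ} {a b : ℝ}
    (hy : ∀ i, AbsolutelyContinuousOnInterval (fun t => y t i) a b)
    (hP : ∀ i j, AbsolutelyContinuousOnInterval (fun t => P t i j) a b) :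
    AbsolutelyContinuousOnInterval (fun t => y t ⬝ᵥ (P t *ᵥ y t)) a b := by
  simp only [dotProduct, mulVec]
  exact .sum _ fun i _ => (hy i).fun_mul (.sum _ fun j _ => (hP i j).fun_mul (hy j))

theorem HasDerivAt.mulVec_mul {k l : ℕ} {y : ℝ → Fin l → ℝ} {P : ℝ → Matrix (Fin k) (Fin l) ℝ}
    {y' : Fin l → ℝ} {P' : Matrix (Fin k) (Fin l) ℝ} {t : ℝ} (hP : HasDerivAt P P' t)
    (hy : HasDerivAt y y' t) :
    HasDerivAt (fun s => P s *ᵥ y s) (P' *ᵥ y t + P t *ᵥ y') t := by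
  refine hasDerivAt_pi.2 fun i => ?_
  have h : HasDerivAt (fun s => P s i) (P' i) t := hasDerivAt_pi.1 hP i
  simpa only [mulVec, Pi.add_apply] using h.matrix_dotProduct hy

theorem HasDerivAt.quadratic_form {y : ℝ → Fin n → ℝ} {P : ℝ → Matrix (Fin n) (Fin n) ℝ}
    {y' : Fin n → ℝ} {P' : Matrix (Fin n) (Fin n) ℝ} {t : ℝ} (hy : HasDerivAt y y' t)
    (hP : HasDerivAt P P' t) (hsymm : (P t)ᵀ = P t) :
    HasDerivAt (fun s => y s ⬝ᵥ (P s *ᵥ y s))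
      (y t ⬝ᵥ (P' *ᵥ y t) + 2 * (y t ⬝ᵥ (P t *ᵥ y'))) t := by
  refine (hy.matrix_dotProduct (hP.mulVec_mul hy)).congr_deriv ?_
  have e : y' ⬝ᵥ (P t *ᵥ y t) = y t ⬝ᵥ (P t *ᵥ y') := by
    rw [dotProduct_mulVec, ← mulVec_transpose, hsymm, dotProduct_comm]
  rw [e, dotProduct_add]
  ring

/-- Energy balance along a trajectory: if `P` solves the backward Riccati equation on `[a, b]`,
then the running cost is the sum of an exact derivative and of a square. -/
theorem IsTrajectory.energy_balance (h : IsTrajectory A B x₀ u x) (hR : Rᵀ = R) {a b : ℝ}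
    (ha : 0 ≤ a) (hab : a ≤ b) {P : ℝ → Matrix (Fin n) (Fin n) ℝ}
    (hP : ∀ t ∈ Set.Icc a b, HasDerivAt P (-riccati A B Q S R (P t)) t)
    (hsymm : ∀ t ∈ Set.Icc a b, (P t)ᵀ = P t)
    (hk : ∀ t ∈ Set.Icc a b, (S + P t * B) * kerProj R = 0) :
    ∃ g : ℝ → ℝ, IntegrableOn g (Set.Icc a b) volume ∧
      ∫ t in Set.Icc a b, g t = x a ⬝ᵥ (P a *ᵥ x a) - x b ⬝ᵥ (P b *ᵥ x b) ∧
      ∀ᵐ t ∂(volume.restrict (Set.Icc a b)),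
        Sum.elim (x t) (u t) ⬝ᵥ (fromBlocks Q S Sᵀ R *ᵥ Sum.elim (x t) (u t)) = g t +
          (u t + (pinv R * (Sᵀ + Bᵀ * P t)) *ᵥ x t) ⬝ᵥ
            (R *ᵥ (u t + (pinv R * (Sᵀ + Bᵀ * P t)) *ᵥ x t)) := by
  have hb : 0 ≤ b := ha.trans hab
  have hsub : Set.uIcc a b ⊆ Set.uIcc 0 b := by
    rw [Set.uIcc_of_le hab, Set.uIcc_of_le hb]
    exact Set.Icc_subset_Icc_left ha
  have hPc : ContinuousOn P (Set.Icc a b) := fun t ht =>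
    continuousWithinAt_pi.2 fun i => continuousWithinAt_pi.2 fun j =>
      (hasDerivAt_pi.1 (hasDerivAt_pi.1 (hP t ht) i) j).continuousAt.continuousWithinAt
  have hP'c : ContinuousOn (fun t => -riccati A B Q S R (P t)) (Set.Icc a b) :=
    (continuous_riccati.comp_continuousOn hPc).neg
  have hPac : ∀ i j, AbsolutelyContinuousOnInterval (fun t => P t i j) a b := fun i j =>
    absolutelyContinuousOnInterval_of_hasDerivAt hab
      (fun t ht => hasDerivAt_pi.1 (hasDerivAt_pi.1 (hP t ht) i) j)
      ((continuous_apply_apply i j).comp_continuousOn hP'c)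
  have hxac : ∀ i, AbsolutelyContinuousOnInterval (fun t => x t i) a b := fun i =>
    (h.absolutelyContinuousOnInterval hb i).mono hsub
  -- The derivative of `xᵀ P x`; the exact part `g` of the running cost is `-q'`.
  set q' : ℝ → ℝ := fun t => x t ⬝ᵥ (-riccati A B Q S R (P t) *ᵥ x t) +
    2 * (x t ⬝ᵥ (P t *ᵥ (A *ᵥ x t + B *ᵥ u t))) with hq'
  have hd : ∀ᵐ t, t ∈ Set.uIcc a b → HasDerivAt (fun t => x t ⬝ᵥ (P t *ᵥ x t)) (q' t) t := by
    filter_upwards [h.ae_hasDerivAt hb] with t ht hmem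
    have hmem' : t ∈ Set.Icc a b := Set.uIcc_of_le hab ▸ hmem
    exact (ht (hsub hmem)).quadratic_form (hP t hmem') (hsymm t hmem')
  obtain ⟨hint, heq⟩ :=
    (AbsolutelyContinuousOnInterval.quadratic_form hxac hPac).intervalIntegrable_and_integral_eq hd
  rw [intervalIntegrable_iff_integrableOn_Icc_of_le hab] at hint
  rw [intervalIntegral.integral_of_le hab, ← integral_Icc_eq_integral_Ioc] at heq
  refine ⟨fun t => -q' t, hint.neg, ?_, ?_⟩
  · rw [integral_neg, heq, neg_sub]
  · filter_upwards [ae_restrict_mem measurableSet_Icc] with t ht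
    have e := completion_of_squares (A := A) (Q := Q) hR (hsymm t ht) (hk t ht) (x t) (u t)
    rw [fromBlocks_form]
    simp only [hq', neg_mulVec, dotProduct_neg]
    linarith

/-- Passing to the positive part of `g` avoids any measurability or integrability assumption on `f`.
-/
theorem ofReal_integral_le_lintegral_ofReal {μ : Measure ℝ} {f g : ℝ → ℝ}
    (hg : Integrable g μ) (hfg : ∀ᵐ t ∂μ, g t ≤ f t) :
    ENNReal.ofReal (∫ t, g t ∂μ) ≤ ∫⁻ t, ENNReal.ofReal (f t) ∂μ := by
  calc ENNReal.ofReal (∫ t, g t ∂μ) ≤ ENNReal.ofReal (∫ t, max (g t) 0 ∂μ) :=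
        ENNReal.ofReal_le_ofReal (integral_mono hg hg.pos_part fun t => le_max_left _ _)
    _ = ∫⁻ t, ENNReal.ofReal (max (g t) 0) ∂μ :=
        ofReal_integral_eq_lintegral_ofReal hg.pos_part (ae_of_all _ fun t => le_max_right _ _)
    _ ≤ ∫⁻ t, ENNReal.ofReal (f t) ∂μ := by
        refine lintegral_mono_ae ?_
        filter_upwards [hfg] with t ht
        rw [ENNReal.ofReal_max, ENNReal.ofReal_zero, max_eq_left (by simp)]
        exact ENNReal.ofReal_le_ofReal ht

/-- The optimal cost over a finite horizon is bounded below by the Riccati flow. -/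
theorem IsTrajectory.le_lintegral_Icc (h : IsTrajectory A B x₀ u x)
    (hPi : (fromBlocks Q S Sᵀ R).PosSemidef) {X : ℝ → Matrix (Fin n) (Fin n) ℝ} (hX0 : X 0 = 0)
    (hX : ∀ t, 0 ≤ t → HasDerivAt X (riccati A B Q S R (X t)) t)
    (hsymm : ∀ t, 0 ≤ t → (X t)ᵀ = X t) (hk : ∀ t, 0 ≤ t → (S + X t * B) * kerProj R = 0)
    {a b : ℝ} (ha : 0 ≤ a) (hab : a ≤ b) :
    ENNReal.ofReal (x a ⬝ᵥ (X (b - a) *ᵥ x a)) ≤ ∫⁻ t in Set.Icc a b, ENNReal.ofReal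
      (Sum.elim (x t) (u t) ⬝ᵥ (fromBlocks Q S Sᵀ R *ᵥ Sum.elim (x t) (u t))) := by
  have hR := posSemidef_of_fromBlocks₂₂ hPi
  -- Reversing time turns the forward flow into a backward one with terminal value `X 0 = 0`.
  obtain ⟨g, hg, hgi, hge⟩ := h.energy_balance (Q := Q) (S := S)
    (Matrix.IsSymm.of_posSemidef hR) ha hab (P := fun t => X (b - t))
    (fun t ht => hasDerivAt_pi.2 fun i => hasDerivAt_pi.2 fun j => by
      simpa using (hasDerivAt_pi.1 (hasDerivAt_pi.1 (hX (b - t) (sub_nonneg.2 ht.2)) i)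
        j).comp_const_sub b t)
    (fun t ht => hsymm _ (sub_nonneg.2 ht.2)) (fun t ht => hk _ (sub_nonneg.2 ht.2))
  have e : x a ⬝ᵥ (X (b - a) *ᵥ x a) = ∫ t in Set.Icc a b, g t := by
    rw [hgi]
    simp [hX0]
  rw [e]
  refine ofReal_integral_le_lintegral_ofReal hg ?_
  filter_upwards [hge] with t ht
  rw [ht]
  exact le_add_of_nonneg_right (hR.dotProduct_nonneg _)

theorem IsTrajectory.aestronglyMeasurable_form (h : IsTrajectory A B x₀ u x) (T : ℝ) :
    AEStronglyMeasurable
      (fun t => Sum.elim (x t) (u t) ⬝ᵥ (fromBlocks Q S Sᵀ R *ᵥ Sum.elim (x t) (u t)))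
      (volume.restrict (Set.Icc 0 T)) := by
  simp only [fromBlocks_form]
  have hx : AEStronglyMeasurable x (volume.restrict (Set.Icc 0 T)) :=
    (h.continuousOn.mono Set.Icc_subset_Ici_self).aestronglyMeasurable measurableSet_Icc
  have hc : Continuous fun p : (Fin n → ℝ) × (Fin m → ℝ) =>
      p.1 ⬝ᵥ (Q *ᵥ p.1) + 2 * (p.1 ⬝ᵥ (S *ᵥ p.2)) + p.2 ⬝ᵥ (R *ᵥ p.2) := by fun_prop
  exact hc.comp_aestronglyMeasurable (hx.prodMk (h.control T).aestronglyMeasurable)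

theorem Ici_zero_eq_iUnion_Icc : Set.Ici (0 : ℝ) = ⋃ k : ℕ, Set.Icc (0 : ℝ) k := by
  ext t
  simp only [Set.mem_Ici, Set.mem_iUnion, Set.mem_Icc]
  exact ⟨fun ht => (exists_nat_ge t).imp fun k hk => ⟨ht, hk⟩, fun ⟨k, hk⟩ => hk.1⟩

theorem ContinuousOn.isL2Loc {f : ℝ → Fin m → ℝ} (hf : ContinuousOn f (Set.Ici 0)) :
    IsL2Loc f := by
  intro T
  have hf' : ContinuousOn f (Set.Icc 0 T) := hf.mono Set.Icc_subset_Ici_self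
  obtain ⟨C, hC⟩ := isCompact_Icc.exists_bound_of_continuousOn hf'
  exact MemLp.of_bound (hf'.aestronglyMeasurable measurableSet_Icc) C
    ((ae_restrict_iff' measurableSet_Icc).2 (ae_of_all _ hC))

theorem lintegral_Ici_le_of_forall_Icc {f : ℝ → ENNReal} {c : ENNReal}
    (h : ∀ T, 0 ≤ T → ∫⁻ t in Set.Icc 0 T, f t ≤ c) : ∫⁻ t in Set.Ici 0, f t ≤ c := by
  have hd : Directed (· ⊆ ·) fun k : ℕ => Set.Icc (0 : ℝ) k :=
    directed_of_isDirected_le fun i j hij => Set.Icc_subset_Icc_right (Nat.cast_le.2 hij)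
  rw [Ici_zero_eq_iUnion_Icc, setLIntegral_iUnion_of_directed f hd]
  exact iSup_le fun k => h k k.cast_nonneg

/-- A feedback control of a positive semidefinite solution costs at most its quadratic form. -/
theorem IsTrajectory.cost_le_of_isFeedback (h : IsTrajectory A B x₀ u x)
    (hPi : (fromBlocks Q S Sᵀ R).PosSemidef) {X : Matrix (Fin n) (Fin n) ℝ} (hX : X.PosSemidef)
    (hc : IsCGCARE A B Q S R X) {v : ℝ → Fin m → ℝ} (hf : IsFeedback B S R X v u x) :
    cost Q S R u x ≤ ENNReal.ofReal (x₀ ⬝ᵥ (X *ᵥ x₀)) := by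
  have hR := posSemidef_of_fromBlocks₂₂ hPi
  have hX' := Matrix.IsSymm.of_posSemidef hX
  have hx0 : x 0 = x₀ := by simpa using h.eq_integral 0 le_rfl
  refine lintegral_Ici_le_of_forall_Icc fun T hT => ?_
  obtain ⟨g, hg, hgi, hge⟩ := h.energy_balance (Q := Q) (S := S)
    (Matrix.IsSymm.of_posSemidef hR) le_rfl hT (P := fun _ => X)
    (fun t ht => hasDerivAt_pi.2 fun i => hasDerivAt_pi.2 fun j => by
      simpa [hc.1] using hasDerivAt_const t (X i j))
    (fun t ht => hX') (fun t ht => ker_le_ker_iff_mul_kerProj.1 hc.2)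
  have hf' := ae_restrict_of_ae_restrict_of_subset 
    (Set.Icc_subset_Ici_self : Set.Icc 0 T ⊆ _) hf
  have hfg : ∀ᵐ t ∂(volume.restrict (Set.Icc 0 T)),
      Sum.elim (x t) (u t) ⬝ᵥ (fromBlocks Q S Sᵀ R *ᵥ Sum.elim (x t) (u t)) = g t := by
    filter_upwards [hge, hf'] with t ht hu
    -- Under the feedback law the residual is `G v`, which `R` kills.
    have e : R *ᵥ (u t + (pinv R * (Sᵀ + Bᵀ * X)) *ᵥ x t) = 0 := by
      rw [hu, add_comm, add_neg_cancel_left, mulVec_mulVec, mul_kerProj_self, zero_mulVec]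
    rw [ht, e, dotProduct_zero, add_zero]
  have hg0 : 0 ≤ᵐ[volume.restrict (Set.Icc 0 T)] g := by
    filter_upwards [hfg] with t ht
    rw [← ht]
    exact hPi.dotProduct_nonneg _
  calc _ = ∫⁻ t in Set.Icc 0 T, ENNReal.ofReal (g t) := by
        refine lintegral_congr_ae ?_
        filter_upwards [hfg] with t ht
        rw [ht]
    _ = ENNReal.ofReal (∫ t in Set.Icc 0 T, g t) :=
        (ofReal_integral_eq_lintegral_ofReal hg hg0).symm
    _ ≤ _ := by
        rw [hgi, hx0]
        exact ENNReal.ofReal_le_ofReal (sub_le_self _ (hX.dotProduct_nonneg _))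

/-- A control whose cost over each finite horizon, together with the terminal value, does not
exceed the initial value is given by the feedback law. -/
theorem IsTrajectory.exists_isFeedback (h : IsTrajectory A B x₀ u x)
    (hPi : (fromBlocks Q S Sᵀ R).PosSemidef) {X : Matrix (Fin n) (Fin n) ℝ} (hX : X.PosSemidef)
    (hc : IsCGCARE A B Q S R X)
    (hle : ∀ T, 0 ≤ T → (∫⁻ t in Set.Icc 0 T, ENNReal.ofReal
      (Sum.elim (x t) (u t) ⬝ᵥ (fromBlocks Q S Sᵀ R *ᵥ Sum.elim (x t) (u t)))) +
      ENNReal.ofReal (x T ⬝ᵥ (X *ᵥ x T)) ≤ ENNReal.ofReal (x₀ ⬝ᵥ (X *ᵥ x₀))) :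
    ∃ v, IsL2Loc v ∧ IsFeedback B S R X v u x := by
  have hR := posSemidef_of_fromBlocks₂₂ hPi
  have hX' := Matrix.IsSymm.of_posSemidef hX
  have hx0 : x 0 = x₀ := by simpa using h.eq_integral 0 le_rfl
  set K := pinv R * (Sᵀ + Bᵀ * X) with hK
  have hzero : ∀ T : ℝ, 0 ≤ T →
      ∀ᵐ t ∂(volume.restrict (Set.Icc 0 T)), R *ᵥ (u t + K *ᵥ x t) = 0 := by
    intro T hT
    obtain ⟨g, hg, hgi, hge⟩ := h.energy_balance (Q := Q) (S := S)
      (Matrix.IsSymm.of_posSemidef hR) le_rfl hT (P := fun _ => X)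
      (fun t ht => hasDerivAt_pi.2 fun i => hasDerivAt_pi.2 fun j => by
      simpa [hc.1] using hasDerivAt_const t (X i j))
      (fun t ht => hX') (fun t ht => ker_le_ker_iff_mul_kerProj.1 hc.2)
    set f : ℝ → ℝ := fun t =>
      Sum.elim (x t) (u t) ⬝ᵥ (fromBlocks Q S Sᵀ R *ᵥ Sum.elim (x t) (u t)) with hf
    have hf0 : ∀ t, 0 ≤ f t := fun t => hPi.dotProduct_nonneg _
    have hT' := hle T hT
    have hfin : ∫⁻ t in Set.Icc 0 T, ENNReal.ofReal (f t) ≠ ⊤ :=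
      ne_top_of_le_ne_top ENNReal.ofReal_ne_top (le_self_add.trans hT')
    have hfi : IntegrableOn f (Set.Icc 0 T) volume :=
      (lintegral_ofReal_ne_top_iff_integrable (h.aestronglyMeasurable_form T)
        (ae_of_all _ hf0)).1 hfin
    have hle' : ∫ t in Set.Icc 0 T, f t ≤ ∫ t in Set.Icc 0 T, g t := by
      rw [← ofReal_integral_eq_lintegral_ofReal hfi (ae_of_all _ hf0),
        ← ENNReal.ofReal_add (integral_nonneg hf0) (hX.dotProduct_nonneg _),
        ENNReal.ofReal_le_ofReal_iff (hX.dotProduct_nonneg _)] at hT'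
      rw [hgi, hx0]
      linarith
    have hnn : 0 ≤ᵐ[volume.restrict (Set.Icc 0 T)] fun t => f t - g t := by
      filter_upwards [hge] with t ht
      change 0 ≤ f t - g t
      rw [show f t = _ from ht, add_sub_cancel_left]
      exact hR.dotProduct_nonneg _
    -- Here `f - g` is almost everywhere the nonnegative square, while `hle'` makes its integral at
    -- most `0`.
    have hz : ∫ t in Set.Icc 0 T, (f t - g t) = 0 := by
      refine le_antisymm ?_ (integral_nonneg_of_ae hnn)
      rw [integral_sub hfi hg]
      linarith
    rw [integral_eq_zero_iff_of_nonneg_ae hnn (hfi.sub hg)] at hz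
    filter_upwards [hz, hge] with t h1 h2
    change f t - g t = 0 at h1
    rw [show f t = _ from h2, add_sub_cancel_left] at h1
    exact (hR.dotProduct_mulVec_zero_iff _).1 (by simpa using h1)
  -- The residual itself serves as `v`: it lies in `ker R` almost everywhere, where `G` acts as the
  -- identity.
  refine ⟨fun t => u t + K *ᵥ x t, fun T => (h.control T).add ?_, ?_⟩
  · have hK' : Continuous fun y : Fin n → ℝ => K *ᵥ y := by fun_prop
    exact (hK'.comp_continuousOn h.continuousOn).isL2Loc T
  · rw [IsFeedback, Ici_zero_eq_iUnion_Icc, ae_restrict_iUnion_iff]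
    intro k
    filter_upwards [hzero k k.cast_nonneg] with t ht
    rw [kerProj_mulVec_eq ht, hK]
    abel

end Energy

/-! ### Existence of closed-loop trajectories. -/

section Existence

variable {n m : ℕ} {A : Matrix (Fin n) (Fin n) ℝ} {B : Matrix (Fin n) (Fin m) ℝ}
  {Q : Matrix (Fin n) (Fin n) ℝ} {S : Matrix (Fin n) (Fin m) ℝ} {R : Matrix (Fin m) (Fin m) ℝ}

section Exp

attribute [local instance] Matrix.linftyOpNormedRing Matrix.linftyOpNormedAlgebra

/-- A fundamental matrix of a linear system, together with its inverse. -/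
theorem exists_fundamental_matrix (F : Matrix (Fin n) (Fin n) ℝ) :
    ∃ E E' : ℝ → Matrix (Fin n) (Fin n) ℝ, E 0 = 1 ∧ (∀ t, HasDerivAt E (F * E t) t) ∧
      Continuous E ∧ Continuous E' ∧ ∀ t, E t * E' t = 1 := by
  refine ⟨fun t => NormedSpace.exp (t • F), fun t => NormedSpace.exp (t • (-F)), by simp,
    fun t => hasDerivAt_exp_smul_const' F t,
    continuous_iff_continuousAt.2 fun t => (hasDerivAt_exp_smul_const' F t).continuousAt,
    continuous_iff_continuousAt.2 fun t => (hasDerivAt_exp_smul_const' (-F) t).continuousAt,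
    fun t => ?_⟩
  rw [← Matrix.exp_add_of_commute]
  · simp
  · exact ((Commute.refl F).neg_right.smul_left t).smul_right t

end Exp

theorem continuousOn_Ici_of_forall_Icc {E : Type*} [TopologicalSpace E] {f : ℝ → E}
    (h : ∀ T, 0 ≤ T → ContinuousOn f (Set.Icc 0 T)) : ContinuousOn f (Set.Ici 0) := by
  intro t ht
  have ht' : (0 : ℝ) ≤ t := ht
  refine (h (t + 1) (by linarith) t ⟨ht, by linarith⟩).mono_of_mem_nhdsWithin ?_
  rw [mem_nhdsWithin]
  exact ⟨Set.Iio (t + 1), isOpen_Iio, by simp, fun s hs => ⟨hs.2, le_of_lt hs.1⟩⟩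

/-- Inhomogeneous linear systems with locally integrable forcing have Carathéodory solutions. -/
theorem exists_caratheodory_solution (F : Matrix (Fin n) (Fin n) ℝ) {b : ℝ → Fin n → ℝ}
    (hb : ∀ T, 0 ≤ T → IntervalIntegrable b volume 0 T) (x₀ : Fin n → ℝ) :
    ∃ x : ℝ → Fin n → ℝ, ContinuousOn x (Set.Ici 0) ∧
      ∀ t, 0 ≤ t → x t = x₀ + ∫ s in (0 : ℝ)..t, (F *ᵥ x s + b s) := by
  obtain ⟨E, E', hE0, hE, hEc, hE'c, hEE'⟩ := exists_fundamental_matrix F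
  have hint : ∀ T, 0 ≤ T → IntervalIntegrable (fun s => E' s *ᵥ b s) volume 0 T := by
    intro T hT
    have hi : ∀ i, IntervalIntegrable (fun s => (E' s *ᵥ b s) i) volume 0 T := by
      intro i
      simp only [mulVec, dotProduct]
      have h := IntervalIntegrable.sum Finset.univ (f := fun j s => E' s i j * b s j)
        fun j _ => ((hb T hT).apply j).continuousOn_mul
          ((continuous_apply_apply i j).comp hE'c).continuousOn
      simpa only [Finset.sum_fn] using h
    exact ⟨Integrable.of_eval fun i => (hi i).1, Integrable.of_eval fun i => (hi i).2⟩
  -- Variation of constants: the solution is `E c`.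
  set c : ℝ → Fin n → ℝ := fun t => x₀ + ∫ s in (0 : ℝ)..t, E' s *ᵥ b s with hc
  have hac : ∀ T, 0 ≤ T → ∀ i, AbsolutelyContinuousOnInterval (fun t => (E t *ᵥ c t) i) 0 T := by
    intro T hT i
    simp only [mulVec, dotProduct]
    refine AbsolutelyContinuousOnInterval.sum _ fun j _ => ?_
    refine AbsolutelyContinuousOnInterval.fun_mul ?_
      (absolutelyContinuousOnInterval_primitive (hint T hT) x₀ j)
    refine absolutelyContinuousOnInterval_of_hasDerivAt hT
      (fun t _ => hasDerivAt_pi.1 (hasDerivAt_pi.1 (hE t) i) j) ?_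
    exact ((continuous_apply_apply i j).comp (continuous_const.matrix_mul hEc)).continuousOn
  have hcont : ContinuousOn (fun t => E t *ᵥ c t) (Set.Ici 0) :=
    continuousOn_Ici_of_forall_Icc fun T hT => continuousOn_pi.2 fun i =>
      Set.uIcc_of_le hT ▸ (hac T hT i).continuousOn
  refine ⟨fun t => E t *ᵥ c t, hcont, fun t ht => ?_⟩
  have hd : ∀ᵐ s, s ∈ Set.uIcc 0 t →
      HasDerivAt (fun s => E s *ᵥ c s) (F *ᵥ (E s *ᵥ c s) + b s) s := by
    filter_upwards [(hint t ht).ae_hasDerivAt_integral] with s hs hmem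
    refine ((hE s).mulVec_mul ((hs hmem 0 Set.left_mem_uIcc).const_add x₀)).congr_deriv ?_
    rw [mulVec_mulVec (b s), hEE', one_mulVec, ← mulVec_mulVec]
  have hint' : IntervalIntegrable (fun s => F *ᵥ (E s *ᵥ c s) + b s) volume 0 t := by
    refine IntervalIntegrable.add ?_ (hb t ht)
    rw [intervalIntegrable_iff_integrableOn_Icc_of_le ht]
    exact (hcont.mono Set.Icc_subset_Ici_self).integrableOn_Icc.mulVec F
  funext i
  have h := ((hac t ht i).intervalIntegrable_and_integral_eq (hd.mono fun s hs hmem =>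
    hasDerivAt_pi.1 (hs hmem) i)).2
  rw [Pi.add_apply, intervalIntegral_apply hint', h]
  simp [hc, hE0]

theorem MeasureTheory.MemLp.mulVec {k l : ℕ} {f : ℝ → Fin l → ℝ} {μ : Measure ℝ}
    (hf : MemLp f 2 μ) (F : Matrix (Fin k) (Fin l) ℝ) : MemLp (fun t => F *ᵥ f t) 2 μ :=
  (LinearMap.toContinuousLinearMap F.mulVecLin).comp_memLp' hf

/-- Substituting the feedback law leaves the linear system with matrix `A - B K` and forcing `B G
v`. -/
theorem exists_isTrajectory_isFeedback (X : Matrix (Fin n) (Fin n) ℝ) (x₀ : Fin n → ℝ)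
    {v : ℝ → Fin m → ℝ} (hv : IsL2Loc v) :
    ∃ u x, IsTrajectory A B x₀ u x ∧ IsFeedback B S R X v u x := by
  set K := pinv R * (Sᵀ + Bᵀ * X) with hK
  obtain ⟨x, hxc, hx⟩ := exists_caratheodory_solution (A - B * K)
    (b := fun t => (B * kerProj R) *ᵥ v t) (fun T hT => by
      rw [intervalIntegrable_iff_integrableOn_Icc_of_le hT]
      exact (hv.integrableOn T).mulVec _) x₀
  have hKc : Continuous fun y : Fin n → ℝ => -(K *ᵥ y) := by fun_prop
  refine ⟨fun t => -(K *ᵥ x t) + kerProj R *ᵥ v t, x, ⟨fun T => ?_, hxc, fun t ht => ?_⟩,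
    ae_of_all _ fun t => rfl⟩
  · exact ((hKc.comp_continuousOn hxc).isL2Loc T).add ((hv T).mulVec _)
  · rw [hx t ht]
    congr 2
    funext s
    rw [sub_mulVec, mulVec_add, mulVec_neg, mulVec_mulVec, mulVec_mulVec]
    abel

end Existence

/-! ### The infinite-horizon problem. -/

theorem mainTheorem2 {n m : ℕ}
    (A : Matrix (Fin n) (Fin n) ℝ) (B : Matrix (Fin n) (Fin m) ℝ)
    (Q : Matrix (Fin n) (Fin n) ℝ) (S : Matrix (Fin n) (Fin m) ℝ)
    (R : Matrix (Fin m) (Fin m) ℝ)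
    (hPi : (Matrix.fromBlocks Q S Sᵀ R).PosSemidef)
    (hsol : ∃ X : Matrix (Fin n) (Fin n) ℝ, X.IsSymm ∧ IsCGCARE A B Q S R X)
    (hfin : ∀ x₀ : Fin n → ℝ, ∃ u x, IsTrajectory A B x₀ u x ∧ cost Q S R u x < ⊤) :
    ∃ X : ℝ → Matrix (Fin n) (Fin n) ℝ,
      IsForwardRiccatiSolution A B Q S R X ∧
      (∀ Y, IsForwardRiccatiSolution A B Q S R Y → Set.EqOn Y X (Set.Ici 0)) ∧
      ∃ Xbar : Matrix (Fin n) (Fin n) ℝ,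
        -- (1) convergence to a positive semidefinite solution
        Tendsto X atTop (𝓝 Xbar) ∧
        Xbar.PosSemidef ∧ IsCGCARE A B Q S R Xbar ∧
        -- (2) the optimal cost, which is attained
        (∀ x₀ : Fin n → ℝ,
          IsLeast {c : ENNReal | ∃ u x, IsTrajectory A B x₀ u x ∧ c = cost Q S R u x}
            (ENNReal.ofReal (x₀ ⬝ᵥ (Xbar *ᵥ x₀)))) ∧
        -- (3) minimality
        (∀ X' : Matrix (Fin n) (Fin n) ℝ, X'.PosSemidef → IsCGCARE A B Q S R X' →
          (X' - Xbar).PosSemidef) ∧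
        -- (4) parametrisation of all optimal controls, every `v` being allowed
        (∀ (x₀ : Fin n → ℝ) (u : ℝ → Fin m → ℝ) (x : ℝ → Fin n → ℝ),
          IsTrajectory A B x₀ u x →
            (IsOptimal A B Q S R x₀ u x ↔ ∃ v, IsL2Loc v ∧ IsFeedback B S R Xbar v u x)) ∧
        (∀ (x₀ : Fin n → ℝ) (v : ℝ → Fin m → ℝ), IsL2Loc v →
          ∃ u x, IsOptimal A B Q S R x₀ u x ∧ IsFeedback B S R Xbar v u x) := by
  obtain ⟨X, hfw, huniq, hX, hpos, hpos', hk⟩ := exists_forwardRiccatiSolution hPi hsol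
  have hsymm : ∀ t, 0 ≤ t → (X t)ᵀ = X t := fun t ht => Matrix.IsSymm.of_posSemidef (hpos t ht)
  have hstart : ∀ {x₀ : Fin n → ℝ} {u x}, IsTrajectory A B x₀ u x → x 0 = x₀ := fun h => by
    simpa using h.eq_integral 0 le_rfl
  have hfinite : ∀ {x₀ : Fin n → ℝ} {u x}, IsTrajectory A B x₀ u x → ∀ {t}, 0 ≤ t →
      ENNReal.ofReal (x₀ ⬝ᵥ (X t *ᵥ x₀)) ≤ cost Q S R u x := by
    intro x₀ u x h t ht
    have h' := h.le_lintegral_Icc hPi hfw.1 hX hsymm hk le_rfl ht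
    rw [hstart h, sub_zero] at h'
    exact h'.trans (lintegral_mono_set Set.Icc_subset_Ici_self)
  obtain ⟨X₁, hlim, hX₁⟩ := exists_tendsto_of_monotone_posSemidef hX hpos hpos' fun x₀ => by
    obtain ⟨u, x, h, hlt⟩ := hfin x₀
    exact ⟨(cost Q S R u x).toReal, fun t ht =>
      (ENNReal.ofReal_le_iff_le_toReal hlt.ne).1 (hfinite h ht)⟩
  have hform : ∀ x : Fin n → ℝ, Tendsto (fun t => ENNReal.ofReal (x ⬝ᵥ (X t *ᵥ x))) atTop
      (𝓝 (ENNReal.ofReal (x ⬝ᵥ (X₁ *ᵥ x)))) := by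
    intro x
    have hc : Continuous fun Y : Matrix (Fin n) (Fin n) ℝ => ENNReal.ofReal (x ⬝ᵥ (Y *ᵥ x)) :=
      ENNReal.continuous_ofReal.comp (by fun_prop)
    exact (hc.tendsto X₁).comp hlim
  have hc₁ : IsCGCARE A B Q S R X₁ := by
    refine ⟨deriv_limit_eq_zero continuous_riccati hX hlim, ker_le_ker_iff_mul_kerProj.2 ?_⟩
    have hc : Continuous fun Y : Matrix (Fin n) (Fin n) ℝ => (S + Y * B) * kerProj R := by fun_prop
    refine tendsto_nhds_unique ((hc.tendsto X₁).comp hlim) (tendsto_const_nhds.congr' ?_)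
    filter_upwards [eventually_ge_atTop 0] with t ht using (hk t ht).symm
  have hlower : ∀ {x₀ : Fin n → ℝ} {u x}, IsTrajectory A B x₀ u x →
      ENNReal.ofReal (x₀ ⬝ᵥ (X₁ *ᵥ x₀)) ≤ cost Q S R u x := by
    intro x₀ u x h
    refine le_of_tendsto (hform x₀) ?_
    filter_upwards [eventually_ge_atTop 0] with t ht using hfinite h ht
  have hopt : ∀ {x₀ : Fin n → ℝ} {u x v}, IsTrajectory A B x₀ u x → IsFeedback B S R X₁ v u x →
      IsOptimal A B Q S R x₀ u x := fun h hf =>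
    ⟨h, fun u' x' h' => (h.cost_le_of_isFeedback hPi hX₁ hc₁ hf).trans (hlower h')⟩
  have hzero : IsL2Loc (fun _ => (0 : Fin m → ℝ)) := fun T => MemLp.zero
  refine ⟨X, hfw, huniq, X₁, hlim, hX₁, hc₁, fun x₀ => ⟨?_, ?_⟩, fun X' hX' hc' => ?_,
    fun x₀ u x h => ⟨fun ho => ?_, fun ⟨v, hv, hf⟩ => hopt h hf⟩, fun x₀ v hv => ?_⟩
  · obtain ⟨u, x, h, hf⟩ := exists_isTrajectory_isFeedback (A := A) (B := B) (S := S) (R := R)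
      X₁ x₀ hzero
    exact ⟨u, x, h, le_antisymm (hlower h) (h.cost_le_of_isFeedback hPi hX₁ hc₁ hf)⟩
  · rintro c ⟨u, x, h, rfl⟩
    exact hlower h
  · refine .of_dotProduct_nonneg ?_ fun x₀ => ?_
    · rw [transpose_sub, Matrix.IsSymm.of_posSemidef hX', Matrix.IsSymm.of_posSemidef hX₁]
    -- The feedback of `X'` with `v = 0` costs at most `x₀ᵀ X' x₀`, and every control costs at least
    -- `x₀ᵀ X₁ x₀`.
    · obtain ⟨u, x, h, hf⟩ := exists_isTrajectory_isFeedback (A := A) (B := B) (S := S) (R := R)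
        X' x₀ hzero
      have hle := (hlower h).trans (h.cost_le_of_isFeedback hPi hX' hc' hf)
      rw [ENNReal.ofReal_le_ofReal_iff (hX'.dotProduct_nonneg x₀)] at hle
      rw [sub_mulVec, dotProduct_sub]
      linarith
  · obtain ⟨u', x', h', hf'⟩ := exists_isTrajectory_isFeedback (A := A) (B := B) (S := S) (R := R)
      X₁ x₀ hzero
    have hcost : cost Q S R u x ≤ ENNReal.ofReal (x₀ ⬝ᵥ (X₁ *ᵥ x₀)) :=
      (ho.2 u' x' h').trans (h'.cost_le_of_isFeedback hPi hX₁ hc₁ hf')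
    refine h.exists_isFeedback hPi hX₁ hc₁ fun T hT => ?_
    -- The cost on `[T, T + t]` is at least `x(T)ᵀ X(t) x(T)`; letting `t → ∞` puts `X₁` in the
    -- terminal term.
    refine le_of_tendsto ((hform (x T)).const_add _) ?_
    filter_upwards [eventually_ge_atTop 0] with t ht
    refine le_trans ?_ hcost
    have hle := h.le_lintegral_Icc hPi hfw.1 hX hsymm hk hT (le_add_of_nonneg_right ht)
    rw [add_sub_cancel_left] at hle
    refine (add_le_add_right hle _).trans ?_
    -- Dropping the endpoint `T` makes the two time intervals disjoint.
    rw [← setLIntegral_congr Ico_ae_eq_Icc, ← lintegral_union measurableSet_Icc]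
    · refine lintegral_mono_set fun s hs => ?_
      exact hs.elim (fun hs => hs.1) fun hs => hT.trans hs.1
    · exact Set.disjoint_left.2 fun s hs hs' => absurd hs'.1 (not_le.2 hs.2)
  · obtain ⟨u, x, h, hf⟩ := exists_isTrajectory_isFeedback (A := A) (B := B) (S := S) (R := R)
      X₁ x₀ hv
    exact ⟨u, x, hopt h hf, hf⟩
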